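/- A \emph{cube complex} $X$ is a quotient of a disjoint union of Euclidean cubes $[-1/2,1/2]^{n_i}$ ($i\in I$) such that the quotient map is injective on the relative interior of every face of every cube, and whenever two points $x,y$ of cubes are identified, there is an isometry from the smallest face containing $x$ onto the smallest face containing $y$ that identifies each point with its image. Its cells are the images of the faces of the cubes, its dimension is $\sup_i n_i$, and $d$ is its intrinsic metric: $d(x,y)$ is the infimum of $\sum_k d_k(x_{k-1},x_k)$ over all finite sequences $x=x_0,\dots,x_m=y$ in which $x_{k-1},x_k$ are points of a common cube, $d_k$ being the Euclidean distance in that cube. $X$ is \emph{CAT(0)} if $(X,d)$ is a geodesic metric space satisfying the CAT(0) inequality for geodesic triangles. For vertices $u,v$ let $D(u,v)$ be the least number of edges in an edge path from $u$ to $v$ in the $1$-skeleton of $X$. \textbf{Technical Lemma.} Let $X$ be a CAT(0) cube complex. Then any two vertices of $X$ are joined by an edge path, and the following hold. \begin{enumerate} \item $D$ is a conditionally negative kernel on the vertex set of $X$: for all vertices $v_1,\dots,v_m$ and all real numbers $\lambda_1,\dots,\lambda_m$ with $\sum_i\lambda_i=0$ we have $\sum_{i,j}\lambda_i\lambda_j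 D(v_i,v_j)\le 0$. \item If a group $G$ acts cellularly on $X$ (each element of $G$ maps each $k$-cell onto a $k$-cell, for all $k$), then $D(gu,gv)=D(u,v)$ for all $g\in G$ and all vertices $u,v$. \item For all vertices $u,v$ we have $d(u,v)\le D(u,v)$; and if $X$ has finite dimension $n$, then $D(u,v)\le\sqrt n\,d(u,v)$. \end{enumerate} -/

import Mathlib

open scoped ENNReal NNReal

universe u v

/-- A conditionally negative kernel on a set `V`. -/
def IsConditionallyNegativeKernel {V : Type u} (f : V → V → ℝ) : Prop :=
  ∀ (s : Finset V) (c : V → ℝ), ∑ x ∈ s, c x = 0 →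
    ∑ x ∈ s, ∑ y ∈ s, c x * c y * f x y ≤ 0

/-- `γ`, restricted to `[0, 1]`, is a geodesic from `x` to `y`, parametrized proportionally to
arc length. -/
def IsGeodesic {M : Type u} [PseudoEMetricSpace M] (γ : ℝ → M) (x y : M) : Prop :=
  γ 0 = x ∧ γ 1 = y ∧
    ∀ s ∈ Set.Icc (0 : ℝ) 1, ∀ t ∈ Set.Icc (0 : ℝ) 1,
      edist (γ s) (γ t) = ENNReal.ofReal |s - t| * edist x y

/-- `M` is a CAT(0) space: its distance is a finite metric, any two points are joined by a
geodesic, and geodesic triangles are no wider than their comparison triangles in the Euclidean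
plane. Any two sides of a triangle have a common vertex, here called `p`. -/
structure IsCAT0 (M : Type u) [PseudoEMetricSpace M] : Prop where
  edist_ne_top : ∀ x y : M, edist x y ≠ ∞
  eq_of_edist_eq_zero : ∀ x y : M, edist x y = 0 → x = y
  exists_geodesic : ∀ x y : M, ∃ γ : ℝ → M, IsGeodesic γ x y
  comparison : ∀ (p q r : M) (α β : ℝ → M), IsGeodesic α p q → IsGeodesic β p r →
    ∀ p' q' r' : EuclideanSpace ℝ (Fin 2),
      edist p' q' = edist p q → edist p' r' = edist p r → edist q' r' = edist q r →
      ∀ s ∈ Set.Icc (0 : ℝ) 1, ∀ t ∈ Set.Icc (0 : ℝ) 1,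
        edist (α s) (β t) ≤ edist (AffineMap.lineMap p' q' s) (AffineMap.lineMap p' r' t)

/-- The Euclidean cube `[-1/2, 1/2]^n`, with the Euclidean metric. -/
abbrev Cube (n : ℕ) : Type :=
  {x : EuclideanSpace ℝ (Fin n) // ∀ i, x i ∈ Set.Icc (-(1 / 2) : ℝ) (1 / 2)}

namespace Cube

/-- The coordinates of `x` that are not `± 1/2`: the directions of the smallest face
containing `x`. -/
noncomputable def freeCoords {n : ℕ} (x : Cube n) : Finset (Fin n) :=
  {i | |x.1 i| ≠ 1 / 2}

/-- The support of `x`: the smallest closed face of the cube containing `x`. Every nonempty face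
of the cube is the support of some point (of its centre, for example), and the relative interior
of a face is the set of the points whose support it is. -/
def support {n : ℕ} (x : Cube n) : Set (Cube n) :=
  {y | ∀ i, i ∉ x.freeCoords → y.1 i = x.1 i}

end Cube

/-- A cube complex: a quotient of a disjoint union of Euclidean cubes, in which the quotient map is
injective on the relative interior of each face of each cube and in which identified points have
their supports identified by an isometry. -/
structure CubeComplex where
  /-- the index set of the cubes -/
  Index : Type u
  /-- the dimensions of the cubes -/
  dim : Index → ℕ
  /-- the identifications -/
  glue : Setoid (Σ i : Index, Cube (dim i))
  injOn_interior : ∀ (i : Index) (x y : Cube (dim i)),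
    x.support = y.support → glue ⟨i, x⟩ ⟨i, y⟩ → x = y
  glue_support : ∀ (i j : Index) (x : Cube (dim i)) (y : Cube (dim j)),
    glue ⟨i, x⟩ ⟨j, y⟩ →
      ∃ h : x.support ≃ᵢ y.support, ∀ z : x.support, glue ⟨i, z.1⟩ ⟨j, (h z).1⟩

namespace CubeComplex

variable (X : CubeComplex.{u})

/-- The points of the cube complex. -/
def Point : Type u := Quotient X.glue

/-- The characteristic map of the `i`-th cube. -/
def proj (i : X.Index) (x : Cube (X.dim i)) : X.Point := Quotient.mk X.glue ⟨i, x⟩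

/-- There is a string of length `ℓ` from `x` to `y`: a finite sequence of points from `x` to `y` in
which each two consecutive points are given as points of a common cube, the length being the sum
of their distances in these cubes. -/
inductive HasString : X.Point → X.Point → ℝ≥0 → Prop
  | nil (x : X.Point) : HasString x x 0
  | cons (i : X.Index) (a b : Cube (X.dim i)) (y : X.Point) (ℓ : ℝ≥0) :
      HasString (X.proj i b) y ℓ → HasString (X.proj i a) y (nndist a b + ℓ)

variable {X}

theorem HasString.trans {x y z : X.Point} {ℓ m : ℝ≥0} (h : X.HasString x y ℓ)
    (h' : X.HasString y z m) : X.HasString x z (ℓ + m) := by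
  induction h with
  | nil x => simpa using h'
  | cons i a b y ℓ _ ih =>
    rw [add_assoc]
    exact .cons i a b z _ (ih h')

theorem HasString.symm {x y : X.Point} {ℓ : ℝ≥0} (h : X.HasString x y ℓ) :
    X.HasString y x ℓ := by
  induction h with
  | nil x => exact .nil x
  | cons i a b y ℓ _ ih =>
    have h1 := HasString.cons i b a _ 0 (.nil (X.proj i a))
    rw [add_zero, nndist_comm] at h1
    rw [add_comm]
    exact ih.trans h1

/-- The intrinsic distance of the cube complex: the infimum of the lengths of strings. -/
noncomputable instance : PseudoEMetricSpace X.Point where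
  edist x y := ⨅ (ℓ : ℝ≥0) (_ : X.HasString x y ℓ), (ℓ : ℝ≥0∞)
  edist_self x := le_antisymm (iInf₂_le_of_le 0 (.nil x) (by simp)) zero_le
  edist_comm x y := le_antisymm
    (le_iInf₂ fun ℓ h => iInf₂_le ℓ h.symm) (le_iInf₂ fun ℓ h => iInf₂_le ℓ h.symm)
  edist_triangle x y z := by
    refine ENNReal.le_iInf₂_add_iInf₂ fun ℓ h m h' => ?_
    exact iInf₂_le_of_le (ℓ + m) (h.trans h') (by simp)

variable (X)

/-- The metric `d` of the cube complex as a real number. -/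
noncomputable def d (x y : X.Point) : ℝ := (edist x y).toReal

/-- The dimension of the cube complex (possibly infinite). -/
noncomputable def dimension : ℕ∞ := ⨆ i, (X.dim i : ℕ∞)

/-- `S` is a closed `k`-dimensional cell of `X`: the image of a `k`-dimensional closed face of one
of the cubes. -/
def IsCell (k : ℕ) (S : Set X.Point) : Prop :=
  ∃ (i : X.Index) (a : Cube (X.dim i)), a.freeCoords.card = k ∧ S = X.proj i '' a.support

/-- The vertices of `X`: the `0`-dimensional cells. -/
def Vertex : Type u := {x : X.Point // X.IsCell 0 {x}}

/-- The graph underlying the `1`-skeleton of `X`: two different vertices are adjacent if they are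
the ends of an edge, i.e. lie in a common `1`-dimensional cell. -/
def oneSkeleton : SimpleGraph X.Vertex where
  Adj u v := u ≠ v ∧ ∃ e : Set X.Point, X.IsCell 1 e ∧ u.1 ∈ e ∧ v.1 ∈ e
  symm := ⟨fun _ _ ⟨h, e, he, hu, hv⟩ => ⟨h.symm, e, he, hv, hu⟩⟩
  loopless := ⟨fun _ h => h.1 rfl⟩

/-- The edge-path metric `D` on the vertices: the length of a shortest edge path. -/
noncomputable def D (x y : X.Vertex) : ℝ := X.oneSkeleton.dist x y

/-- The group `G` acts cellularly on `X`: each element maps each `k`-cell onto a `k`-cell. -/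
def IsCellularAction (G : Type v) [Group G] [MulAction G X.Point] : Prop :=
  ∀ (g : G) (k : ℕ) (S : Set X.Point), X.IsCell k S → X.IsCell k ((fun x => g • x) '' S)

variable {X}

/-- The image `g v` of a vertex `v` under a cellular action. -/
def IsCellularAction.vertexMap {G : Type v} [Group G] [MulAction G X.Point]
    (h : X.IsCellularAction G) (g : G) (x : X.Vertex) : X.Vertex :=
  ⟨g • x.1, by simpa using h g 0 {x.1} x.2⟩

end CubeComplex

/-! The edge-path distance counts hyperplanes. A hyperplane is a parallelism class of coordinate
directions of cubes (`Par`), and its sides are read off from the metric: a vertex `v` lies on the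
negative side of the direction `(i, k)` if the distance to `v` is smaller at coordinate `-1/4` than
at `1/4` (`IsNeg`).

The heart is `exists_par_of_d_eq`. If the distance to `v` takes the same value at two points that
differ only in coordinate `k`, it has a local extremum in between. By CAT(0) convexity a local
maximum is also a local minimum. A local minimum in direction `k` propagates along the geodesic to
`v`, with a direction parallel to `k` that stays free, so `v` itself has a free coordinate parallel
to `k`. A vertex has no free coordinates, so its distance is strictly monotone in every coordinate.
By connectedness the direction of monotonicity is constant on each cube, and whether two vertices
lie on the same side depends only on the parallelism class (`isNeg_par`).

An edge crosses exactly its dual hyperplane (`isNeg_flip`). The initial segment of a geodesic from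
`x` to `y` lies in a cube with corner `x`, and some edge at that corner is dual to a hyperplane
separating `x` from `y` (`exists_flip_separating`). Hence `D` is the number of separating
hyperplanes (`D_eq_ncard`), a sum of squared differences of indicator functions, and so
conditionally negative.

Connectedness and `D ≤ √n d` come from pushing a string to an edge path while controlling the
`ℓ¹`-distance, which is at most `√n` times the Euclidean one (`exists_walk_of_string`). The bound `d
≤ D` holds because edges have length one, and invariance because a cellular action induces graph
automorphisms. -/

namespace Cube

/-! ### Isometries between faces of cubes -/

variable {n m : ℕ}

theorem mem_freeCoords {x : Cube n} {i : Fin n} : i ∈ x.freeCoords ↔ |x.1 i| ≠ 1 / 2 := by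
  simp [freeCoords]

theorem abs_le (x : Cube n) (i : Fin n) : |x.1 i| ≤ 1 / 2 :=
  _root_.abs_le.2 ⟨(x.2 i).1, (x.2 i).2⟩

theorem abs_lt_of_mem {x : Cube n} {i : Fin n} (h : i ∈ x.freeCoords) : |x.1 i| < 1 / 2 :=
  lt_of_le_of_ne (x.abs_le i) (mem_freeCoords.1 h)

theorem mem_freeCoords_of_abs_lt {x : Cube n} {i : Fin n} (h : |x.1 i| < 1 / 2) :
    i ∈ x.freeCoords := mem_freeCoords.2 h.ne

theorem self_mem_support (x : Cube n) : x ∈ x.support := fun _ _ => rfl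

theorem ext_coord {x y : Cube n} (h : ∀ i, x.1 i = y.1 i) : x = y :=
  Subtype.ext (PiLp.ext h)

theorem dist_sq (x y : Cube n) : dist x y ^ 2 = ∑ i, (x.1 i - y.1 i) ^ 2 := by
  rw [Subtype.dist_eq, EuclideanSpace.dist_eq, Real.sq_sqrt (by positivity)]
  simp [Real.dist_eq, sq_abs]

theorem abs_sub_le_dist (x y : Cube n) (i : Fin n) : |x.1 i - y.1 i| ≤ dist x y := by
  refine abs_le_of_sq_le_sq ?_ dist_nonneg
  rw [dist_sq]
  exact Finset.single_le_sum (f := fun i => (x.1 i - y.1 i) ^ 2) (fun _ _ => sq_nonneg _)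
    (Finset.mem_univ i)

theorem dist_sq_of_mem_support {x z w : Cube n} (hz : z ∈ x.support) (hw : w ∈ x.support) :
    dist z w ^ 2 = ∑ i ∈ x.freeCoords, (z.1 i - w.1 i) ^ 2 := by
  rw [dist_sq]
  symm
  refine Finset.sum_subset (Finset.subset_univ _) fun i _ hi => ?_
  rw [hz i hi, hw i hi, sub_self]
  norm_num

/-- The point of the support of `x` whose free coordinates are those of `f`. -/
noncomputable def ofFree (x : Cube n) (f : Fin n → ℝ) (hf : ∀ i, |f i| ≤ 1 / 2) : Cube n :=
  ⟨WithLp.toLp 2 fun i => if i ∈ x.freeCoords then f i else x.1 i, fun i => by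
    change (if i ∈ x.freeCoords then f i else x.1 i) ∈ _
    split_ifs
    · exact _root_.abs_le.1 (hf i)
    · exact x.2 i⟩

theorem ofFree_apply (x : Cube n) (f : Fin n → ℝ) (hf : ∀ i, |f i| ≤ 1 / 2) (i : Fin n) :
    (x.ofFree f hf).1 i = if i ∈ x.freeCoords then f i else x.1 i := rfl

theorem ofFree_mem_support (x : Cube n) (f : Fin n → ℝ) (hf : ∀ i, |f i| ≤ 1 / 2) :
    x.ofFree f hf ∈ x.support := fun i hi => by simp [ofFree_apply, hi]

theorem sub_sq_le_one (z w : Cube n) (i : Fin n) : (z.1 i - w.1 i) ^ 2 ≤ 1 := by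
  have h1 := z.2 i
  have h2 := w.2 i
  rw [Set.mem_Icc] at h1 h2
  nlinarith

theorem dist_sq_le_card {x z w : Cube n} (hz : z ∈ x.support) (hw : w ∈ x.support) :
    dist z w ^ 2 ≤ x.freeCoords.card := by
  rw [dist_sq_of_mem_support hz hw]
  calc _ ≤ ∑ i ∈ x.freeCoords, (1 : ℝ) := Finset.sum_le_sum fun i _ => sub_sq_le_one z w i
    _ = _ := by simp

/-- Each free coordinate contributes at most one to the squared distance, so equality forces every
contribution to be one. This characterizes opposite corners of a face metrically. -/
theorem antipodal_of_dist_sq_eq {x z w : Cube n} (hz : z ∈ x.support) (hw : w ∈ x.support)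
    (h : dist z w ^ 2 = x.freeCoords.card) {i : Fin n} (hi : i ∈ x.freeCoords) :
    w.1 i = -z.1 i ∧ (z.1 i = 1 / 2 ∨ z.1 i = -(1 / 2)) := by
  have h0 : ∑ i ∈ x.freeCoords, (z.1 i - w.1 i) ^ 2 = ∑ i ∈ x.freeCoords, (1 : ℝ) := by
    rw [← dist_sq_of_mem_support hz hw, h]
    simp
  have h1 := (Finset.sum_eq_sum_iff_of_le fun i _ => sub_sq_le_one z w i).1 h0 i hi
  have hz' := z.2 i
  have hw' := w.2 i
  rw [Set.mem_Icc] at hz' hw'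
  have h2 : (z.1 i - w.1 i - 1) * (z.1 i - w.1 i + 1) = 0 := by linarith
  rcases mul_eq_zero.1 h2 with h3 | h3
  · exact ⟨by linarith, Or.inl (by linarith)⟩
  · exact ⟨by linarith, Or.inr (by linarith)⟩

variable {x : Cube n} {y : Cube m}

theorem card_freeCoords_le (h : x.support ≃ᵢ y.support) :
    x.freeCoords.card ≤ y.freeCoords.card := by
  let p := x.ofFree (fun _ => 1 / 2) (fun _ => by norm_num [abs_of_pos])
  let q := x.ofFree (fun _ => -(1 / 2)) (fun _ => by norm_num [abs_of_pos])
  have hp : p ∈ x.support := ofFree_mem_support _ _ _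
  have hq : q ∈ x.support := ofFree_mem_support _ _ _
  have h1 : dist p q ^ 2 = x.freeCoords.card := by
    rw [dist_sq_of_mem_support hp hq, Finset.card_eq_sum_ones, Nat.cast_sum]
    refine Finset.sum_congr rfl fun i hi => ?_
    simp only [p, q, ofFree_apply, if_pos hi]
    norm_num
  have h2 := dist_sq_le_card (h ⟨p, hp⟩).2 (h ⟨q, hq⟩).2
  have h3 : dist (h ⟨p, hp⟩).1 (h ⟨q, hq⟩).1 = dist p q := h.dist_eq ⟨p, hp⟩ ⟨q, hq⟩
  rw [h3, h1] at h2
  exact_mod_cast h2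

theorem card_freeCoords_eq (h : x.support ≃ᵢ y.support) :
    x.freeCoords.card = y.freeCoords.card :=
  le_antisymm (card_freeCoords_le h) (card_freeCoords_le h.symm)

/-- An isometry of faces maps corners to corners and preserves the inner products with them. -/
theorem corner_map (h : x.support ≃ᵢ y.support) (c : x.support)
    (hc : ∀ i ∈ x.freeCoords, c.1.1 i = 1 / 2 ∨ c.1.1 i = -(1 / 2)) :
    (∀ l ∈ y.freeCoords, (h c).1.1 l = 1 / 2 ∨ (h c).1.1 l = -(1 / 2)) ∧
    ∀ z : x.support, ∑ l ∈ y.freeCoords, (h z).1.1 l * (h c).1.1 l =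
      ∑ i ∈ x.freeCoords, z.1.1 i * c.1.1 i := by
  have ha : ∀ i, |-c.1.1 i| ≤ 1 / 2 := fun i => by rw [abs_neg]; exact c.1.abs_le i
  -- The corner opposite to `c`. Since `a = -c` in the free coordinates, inner products with `c` are
  -- differences of squared distances to `a` and `c`, which an isometry preserves.
  let a : x.support := ⟨x.ofFree (fun i => -c.1.1 i) ha, ofFree_mem_support _ _ _⟩
  have hai : ∀ i ∈ x.freeCoords, a.1.1 i = -c.1.1 i := fun i hi => by
    simp only [a, ofFree_apply, if_pos hi]
  have h1 : dist c.1 a.1 ^ 2 = x.freeCoords.card := by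
    rw [dist_sq_of_mem_support c.2 a.2, Finset.card_eq_sum_ones, Nat.cast_sum]
    refine Finset.sum_congr rfl fun i hi => ?_
    rw [hai i hi]
    rcases hc i hi with h | h <;> rw [h] <;> norm_num
  have hd : ∀ z w : x.support, dist (h z).1 (h w).1 = dist z.1 w.1 := fun z w => h.dist_eq z w
  have h2 := fun l hl => antipodal_of_dist_sq_eq (i := l) (h c).2 (h a).2
    (by rw [hd, h1, card_freeCoords_eq h]) hl
  refine ⟨fun l hl => (h2 l hl).2, fun z => ?_⟩
  have h3 : dist z.1 a.1 ^ 2 - dist z.1 c.1 ^ 2 =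
      4 * ∑ i ∈ x.freeCoords, z.1.1 i * c.1.1 i := by
    rw [dist_sq_of_mem_support z.2 a.2, dist_sq_of_mem_support z.2 c.2, ← Finset.sum_sub_distrib,
      Finset.mul_sum]
    refine Finset.sum_congr rfl fun i hi => ?_
    rw [hai i hi]
    ring
  have h4 : dist (h z).1 (h a).1 ^ 2 - dist (h z).1 (h c).1 ^ 2 =
      4 * ∑ i ∈ y.freeCoords, (h z).1.1 i * (h c).1.1 i := by
    rw [dist_sq_of_mem_support (h z).2 (h a).2, dist_sq_of_mem_support (h z).2 (h c).2,
      ← Finset.sum_sub_distrib, Finset.mul_sum]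
    refine Finset.sum_congr rfl fun i hi => ?_
    rw [(h2 i hi).1]
    ring
  rw [hd, hd] at h4
  linarith

/-- An isometry of faces permutes the coordinates up to signs. -/
theorem exists_coord_map (h : x.support ≃ᵢ y.support) {k : Fin n} (hk : k ∈ x.freeCoords) :
    ∃ l ∈ y.freeCoords, ∃ τ : ℝ, (τ = 1 ∨ τ = -1) ∧
      ∀ z : x.support, (h z).1.1 l = τ * z.1.1 k := by
  classical
  let c : x.support := ⟨x.ofFree (fun _ => 1 / 2) (fun _ => by norm_num [abs_of_pos]),
    ofFree_mem_support _ _ _⟩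
  let c' : x.support := ⟨x.ofFree (fun i => if i = k then -(1 / 2) else 1 / 2)
    (fun i => by split_ifs <;> norm_num [abs_of_pos]), ofFree_mem_support _ _ _⟩
  have hc : ∀ i ∈ x.freeCoords, c.1.1 i = 1 / 2 := fun i hi => by
    simp only [c, ofFree_apply, if_pos hi]
  have hc' : ∀ i ∈ x.freeCoords, c'.1.1 i = if i = k then -(1 / 2) else 1 / 2 := fun i hi => by
    simp only [c', ofFree_apply, if_pos hi]
  obtain ⟨hcm, hci⟩ := corner_map h c fun i hi => Or.inl (hc i hi)
  obtain ⟨hcm', hci'⟩ := corner_map h c' fun i hi => by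
    rw [hc' i hi]; split_ifs <;> simp
  -- The corners `c` and `c'` are the ends of an edge in direction `k`. Their images are corners at
  -- distance one, hence differ in a single coordinate `l`; pairing with the two differences of
  -- corners identifies coordinate `k` with coordinate `l` up to sign.
  have h1 : ∑ l ∈ y.freeCoords, ((h c).1.1 l - (h c').1.1 l) ^ 2 = 1 := by
    rw [← dist_sq_of_mem_support (h c).2 (h c').2]
    have : dist (h c).1 (h c').1 = dist c.1 c'.1 := h.dist_eq c c'
    rw [this, dist_sq_of_mem_support c.2 c'.2, Finset.sum_eq_single_of_mem k hk]
    · rw [hc k hk, hc' k hk, if_pos rfl]; norm_num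
    · intro i hi hik
      rw [hc i hi, hc' i hi, if_neg hik]; norm_num
  obtain ⟨l, hl, hl0⟩ := Finset.exists_ne_zero_of_sum_ne_zero (h1.trans_ne one_ne_zero)
  have hτ : (h c).1.1 l - (h c').1.1 l = 1 ∨ (h c).1.1 l - (h c').1.1 l = -1 := by
    rcases hcm l hl with h2 | h2 <;> rcases hcm' l hl with h3 | h3 <;> rw [h2, h3] at hl0 ⊢
    · exact absurd (by norm_num) hl0
    · exact Or.inl (by norm_num)
    · exact Or.inr (by norm_num)
    · exact absurd (by norm_num) hl0
  have hoff : ∀ i ∈ y.freeCoords, i ≠ l → (h c).1.1 i - (h c').1.1 i = 0 := by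
    rw [← Finset.add_sum_erase _ _ hl] at h1
    have h2 : ((h c).1.1 l - (h c').1.1 l) ^ 2 = 1 := by
      rcases hτ with h2 | h2 <;> rw [h2] <;> norm_num
    rw [h2, add_eq_left, Finset.sum_eq_zero_iff_of_nonneg fun _ _ => sq_nonneg _] at h1
    exact fun i hi hil => pow_eq_zero_iff (two_ne_zero) |>.1 (h1 i (Finset.mem_erase.2 ⟨hil, hi⟩))
  refine ⟨l, hl, _, hτ, fun z => ?_⟩
  have h2 := hci z
  have h3 := hci' z
  have h4 : ∑ l ∈ y.freeCoords, (h z).1.1 l * ((h c).1.1 l - (h c').1.1 l) =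
      ∑ i ∈ x.freeCoords, z.1.1 i * (c.1.1 i - c'.1.1 i) := by
    simp only [mul_sub, Finset.sum_sub_distrib]
    rw [h2, h3]
  rw [Finset.sum_eq_single_of_mem l hl fun i hi hil => by rw [hoff i hi hil, mul_zero],
    Finset.sum_eq_single_of_mem k hk fun i hi hik => by
      rw [hc i hi, hc' i hi, if_neg hik]; ring, hc k hk, hc' k hk, if_pos rfl] at h4
  rcases hτ with h5 | h5 <;> rw [h5] at h4 ⊢ <;> linarith

/-- The point `x` with its `k`-th coordinate changed to `s` (cut off at `± 1/2`). -/
noncomputable def upd (x : Cube n) (k : Fin n) (s : ℝ) : Cube n :=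
  ⟨WithLp.toLp 2 fun i => if i = k then max (-(1 / 2)) (min (1 / 2) s) else x.1 i, fun i => by
    change (if i = k then max (-(1 / 2)) (min (1 / 2) s) else x.1 i) ∈ _
    split_ifs
    · exact ⟨le_max_left _ _, max_le (by norm_num) (min_le_left _ _)⟩
    · exact x.2 i⟩

theorem upd_of_ne (x : Cube n) {k i : Fin n} (s : ℝ) (h : i ≠ k) : (x.upd k s).1 i = x.1 i :=
  if_neg h

theorem upd_self (x : Cube n) (k : Fin n) {s : ℝ} (h : |s| ≤ 1 / 2) : (x.upd k s).1 k = s := by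
  have h' := _root_.abs_le.1 h
  refine (if_pos rfl).trans ?_
  rw [min_eq_right h'.2, max_eq_right h'.1]

theorem upd_apply (x : Cube n) (k i : Fin n) {s : ℝ} (h : |s| ≤ 1 / 2) :
    (x.upd k s).1 i = if i = k then s else x.1 i := by
  split_ifs with hi
  · rw [hi, upd_self x k h]
  · exact upd_of_ne x s hi

theorem upd_eq_self (x : Cube n) (k : Fin n) : x.upd k (x.1 k) = x :=
  ext_coord fun i => by
    rw [upd_apply x k i (x.abs_le k)]; split_ifs with h
    · rw [h]
    · rfl

theorem upd_upd (x : Cube n) (k : Fin n) (s t : ℝ) : (x.upd k s).upd k t = x.upd k t :=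
  ext_coord fun i => by
    by_cases h : i = k
    · exact (if_pos h).trans (if_pos h).symm
    · rw [upd_of_ne _ _ h, upd_of_ne _ _ h, upd_of_ne _ _ h]

theorem upd_mem_support {k : Fin n} (hk : k ∈ x.freeCoords) (s : ℝ) : x.upd k s ∈ x.support :=
  fun _ hi => upd_of_ne x s fun h => hi (h ▸ hk)

theorem dist_upd_upd (x : Cube n) (k : Fin n) {s t : ℝ} (hs : |s| ≤ 1 / 2) (ht : |t| ≤ 1 / 2) :
    dist (x.upd k s) (x.upd k t) = |s - t| := by
  rw [← abs_of_nonneg (dist_nonneg (x := x.upd k s) (y := x.upd k t)), ← sq_eq_sq_iff_abs_eq_abs,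
    dist_sq, Finset.sum_eq_single_of_mem k (Finset.mem_univ k) fun i _ hi => by
      rw [upd_of_ne _ _ hi, upd_of_ne _ _ hi, sub_self]; norm_num,
    upd_self x k hs, upd_self x k ht]

theorem dist_upd_self (x : Cube n) (k : Fin n) {s : ℝ} (hs : |s| ≤ 1 / 2) :
    dist (x.upd k s) x = |s - x.1 k| := by
  conv_lhs => rw [← upd_eq_self x k, upd_upd]
  exact dist_upd_upd x k hs (x.abs_le k)

theorem dist_upd_upd_le (x y : Cube n) (k : Fin n) (s : ℝ) :
    dist (x.upd k s) (y.upd k s) ≤ dist x y := by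
  refine abs_le_of_sq_le_sq' ?_ dist_nonneg |>.2
  rw [dist_sq, dist_sq]
  refine Finset.sum_le_sum fun i _ => ?_
  by_cases h : i = k
  · subst h
    have : (x.upd i s).1 i = (y.upd i s).1 i := (if_pos rfl).trans (if_pos rfl).symm
    rw [this, sub_self]
    simpa using sq_nonneg _
  · rw [upd_of_ne _ _ h, upd_of_ne _ _ h]

theorem dist_upd_lt {x y : Cube n} {k : Fin n} {s : ℝ} (hs : |s| ≤ 1 / 2)
    (h : |s - y.1 k| < |x.1 k - y.1 k|) : dist (x.upd k s) y < dist x y := by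
  refine lt_of_pow_lt_pow_left₀ 2 dist_nonneg ?_
  rw [dist_sq, dist_sq]
  refine Finset.sum_lt_sum (fun i _ => ?_) ⟨k, Finset.mem_univ k, ?_⟩
  · by_cases hi : i = k
    · rw [hi, upd_self x k hs]
      exact (sq_lt_sq.2 h).le
    · rw [upd_of_ne _ _ hi]
  · rw [upd_self x k hs]
    exact sq_lt_sq.2 h

theorem support_eq_of_mem {x y : Cube n} (h : x ∈ y.support) (hf : y.freeCoords ⊆ x.freeCoords) :
    x.support = y.support := by
  have hfe : x.freeCoords = y.freeCoords := by
    refine Finset.Subset.antisymm (fun i hi => ?_) hf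
    by_contra hiy
    rw [mem_freeCoords, h i hiy] at hi
    exact hiy (mem_freeCoords.2 hi)
  ext z
  refine forall_congr' fun i => ?_
  rw [hfe]
  exact forall_congr' fun hi => by rw [h i hi]

end Cube

/-! ### Identified points and parallel coordinate directions -/

namespace CubeComplex

variable {X : CubeComplex.{u}}

theorem glue_of_proj_eq {i j : X.Index} {x : Cube (X.dim i)} {y : Cube (X.dim j)}
    (h : X.proj i x = X.proj j y) : X.glue ⟨i, x⟩ ⟨j, y⟩ := Quotient.exact h

theorem proj_eq_of_glue {i j : X.Index} {x : Cube (X.dim i)} {y : Cube (X.dim j)}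
    (h : X.glue ⟨i, x⟩ ⟨j, y⟩) : X.proj i x = X.proj j y := Quotient.sound h

/-- Points of the cubes with the same image have their supports identified by an isometry, which
maps the one to the other. -/
theorem exists_isometry {i j : X.Index} {x : Cube (X.dim i)} {y : Cube (X.dim j)}
    (hxy : X.proj i x = X.proj j y) :
    ∃ h : x.support ≃ᵢ y.support, (∀ z, X.proj i z.1 = X.proj j (h z).1) ∧
      (h ⟨x, x.self_mem_support⟩).1 = y := by
  obtain ⟨h, hh⟩ := X.glue_support i j x y (glue_of_proj_eq hxy)
  refine ⟨h, fun z => proj_eq_of_glue (hh z), ?_⟩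
  refine X.injOn_interior j _ _ ?_
    (glue_of_proj_eq ((proj_eq_of_glue (hh ⟨x, x.self_mem_support⟩)).symm.trans hxy))
  -- The axioms do not say that `h` maps `x` to `y`. Free coordinates of `y` come from free
  -- coordinates of `x`, so the image of `x` is interior to the same face as `y`, where the quotient
  -- map is injective.
  refine Cube.support_eq_of_mem (h _).2 fun l hl => ?_
  obtain ⟨k, hk, τ, hτ, hkl⟩ := Cube.exists_coord_map h.symm hl
  have h1 := hkl (h ⟨x, x.self_mem_support⟩)
  rw [h.symm_apply_apply] at h1
  have h2 := Cube.abs_lt_of_mem hk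
  refine Cube.mem_freeCoords_of_abs_lt ?_
  rw [h1] at h2
  rcases hτ with rfl | rfl <;> simpa using h2

/-- The free coordinate directions `(i, k)` and `(j, l)` are identified along a common face. -/
def Step (X : CubeComplex.{u}) (c c' : Σ i : X.Index, Fin (X.dim i)) : Prop :=
  ∃ (x : Cube (X.dim c.1)) (y : Cube (X.dim c'.1)) (τ : ℝ), (τ = 1 ∨ τ = -1) ∧
    ∀ s : ℝ, |s| ≤ 1 / 2 → X.proj c.1 (x.upd c.2 s) = X.proj c'.1 (y.upd c'.2 (τ * s))

/-- Parallelism of coordinate directions. -/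
def Par (X : CubeComplex.{u}) : Setoid (Σ i : X.Index, Fin (X.dim i)) :=
  Relation.EqvGen.setoid X.Step

theorem par_of_step {c c' : Σ i : X.Index, Fin (X.dim i)} (h : X.Step c c') : X.Par c c' :=
  Relation.EqvGen.rel _ _ h

/-- The isometry of supports carries the line through `x` in direction `k` to the line through `y`
in direction `l`: it permutes coordinates up to signs, so the others stay fixed. -/
theorem exists_coord_of_proj_eq {i j : X.Index} {x : Cube (X.dim i)} {y : Cube (X.dim j)}
    (hxy : X.proj i x = X.proj j y) {k : Fin (X.dim i)} (hk : k ∈ x.freeCoords) :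
    ∃ l ∈ y.freeCoords, ∃ τ : ℝ, (τ = 1 ∨ τ = -1) ∧ y.1 l = τ * x.1 k ∧
      ∀ s : ℝ, |s| ≤ 1 / 2 → X.proj i (x.upd k s) = X.proj j (y.upd l (τ * s)) := by
  obtain ⟨h, hh, hx⟩ := exists_isometry hxy
  obtain ⟨l, hl, τ, hτ, hkl⟩ := Cube.exists_coord_map h hk
  have hxl : y.1 l = τ * x.1 k := by
    have := hkl ⟨x, x.self_mem_support⟩
    rwa [hx] at this
  refine ⟨l, hl, τ, hτ, hxl, fun s hs => ?_⟩
  let z : x.support := ⟨x.upd k s, Cube.upd_mem_support hk s⟩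
  have hτs : |τ * s| ≤ 1 / 2 := by rcases hτ with rfl | rfl <;> simpa using hs
  have hz : (h z).1 = y.upd l (τ * s) := by
    refine Cube.ext_coord fun l' => ?_
    by_cases hl' : l' = l
    · rw [hl', Cube.upd_self y l hτs, hkl z, Cube.upd_self x k hs]
    rw [Cube.upd_of_ne _ _ hl']
    by_cases hf : l' ∈ y.freeCoords
    · obtain ⟨k', hk', τ', hτ', hkl'⟩ := Cube.exists_coord_map h.symm hf
      by_cases hkk : k' = k
      · exfalso
        -- If `l` and `l'` both came from `k`, these two coordinates would agree up to sign on the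
        -- whole face; varying `l'` alone refutes this.
        have key : ∀ w : y.support, w.1.1 l = τ * (τ' * w.1.1 l') := fun w => by
          rw [← hkl' w, hkk, ← hkl, h.apply_symm_apply]
        have h1 := key ⟨y.upd l' (1 / 2), Cube.upd_mem_support hf _⟩
        have h2 := key ⟨y.upd l' (-(1 / 2)), Cube.upd_mem_support hf _⟩
        simp only [Cube.upd_of_ne _ _ (Ne.symm hl')] at h1 h2
        rw [Cube.upd_self y l' (by norm_num [abs_of_pos])] at h1
        rw [Cube.upd_self y l' (by norm_num [abs_of_pos])] at h2
        rcases hτ with rfl | rfl <;> rcases hτ' with rfl | rfl <;> linarith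
      · have h1 := hkl' (h z)
        have h2 := hkl' (h ⟨x, x.self_mem_support⟩)
        rw [h.symm_apply_apply] at h1 h2
        rw [hx] at h2
        have h3 : z.1.1 k' = x.1 k' := Cube.upd_of_ne _ _ hkk
        rw [h3] at h1
        have h1' : x.1 k' = τ' * (h z).1.1 l' := h1
        have h2' : x.1 k' = τ' * y.1 l' := h2
        rcases hτ' with rfl | rfl <;> linarith
    · exact (h z).2 l' hf
  rw [← hz]
  exact hh z

end CubeComplex

/-! ### Small balls: lifting strings and local isometry -/

namespace Cube

variable {n : ℕ}

/-- `r` is at most the distance of `x` to the faces of the cube that do not contain `x`, also in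
all larger cubes. -/
def IsRadius (x : Cube n) (r : ℝ) : Prop :=
  r ≤ 1 ∧ ∀ k ∈ x.freeCoords, r ≤ 1 / 2 - |x.1 k|

theorem exists_isRadius (x : Cube n) : ∃ r > 0, x.IsRadius r := by
  have h : ∀ᶠ r in nhdsWithin (0 : ℝ) (Set.Ioi 0), 0 < r ∧ x.IsRadius r := by
    refine (eventually_mem_nhdsWithin).and (Filter.Eventually.and ?_ ?_)
    · exact nhdsWithin_le_nhds (Iic_mem_nhds one_pos)
    · refine (Filter.eventually_all_finset _).2 fun k hk => ?_
      exact nhdsWithin_le_nhds (Iic_mem_nhds (sub_pos.2 (abs_lt_of_mem hk)))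
  exact h.exists

/-- Coordinates free at `x` are too far from `± 1/2` to become fixed at `a`. A coordinate fixed at
`a` is thus fixed at `x`, and two values `± 1/2` less than one apart coincide. -/
theorem IsRadius.mem_support {x a : Cube n} {r : ℝ} (hr : x.IsRadius r) (h : dist x a < r) :
    x ∈ a.support ∧ x.freeCoords ⊆ a.freeCoords := by
  have hf : x.freeCoords ⊆ a.freeCoords := fun i hi => by
    refine mem_freeCoords_of_abs_lt ?_
    have h1 := hr.2 i hi
    have h2 := abs_sub_le_dist x a i
    have h3 := abs_sub_abs_le_abs_sub (a.1 i) (x.1 i)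
    rw [abs_sub_comm] at h3
    linarith
  refine ⟨fun i hi => ?_, hf⟩
  have h1 : |a.1 i| = 1 / 2 := by simpa [mem_freeCoords] using hi
  have h2 : |x.1 i| = 1 / 2 := by simpa [mem_freeCoords] using fun h => hi (hf h)
  have h3 := (abs_lt.1 ((abs_sub_le_dist x a i).trans_lt (h.trans_le hr.1)))
  rcases eq_or_eq_neg_of_abs_eq h1 with h1 | h1 <;>
    rcases eq_or_eq_neg_of_abs_eq h2 with h2 | h2 <;>
    rw [h1, h2] at h3 ⊢ <;> norm_num at h3

theorem isRadius_one {x : Cube n} (h : x.freeCoords = ∅) : x.IsRadius 1 :=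
  ⟨le_rfl, fun k hk => by simp [h] at hk⟩

end Cube

namespace CubeComplex

variable {X : CubeComplex.{u}}

theorem isRadius_of_proj_eq {i j : X.Index} {x : Cube (X.dim i)} {y : Cube (X.dim j)}
    (hxy : X.proj i x = X.proj j y) {r : ℝ} (hr : x.IsRadius r) : y.IsRadius r := by
  refine ⟨hr.1, fun l hl => ?_⟩
  obtain ⟨k, hk, τ, hτ, h, -⟩ := exists_coord_of_proj_eq hxy.symm hl
  have h1 := hr.2 k hk
  rw [h] at h1
  rcases hτ with rfl | rfl <;> simpa using h1

/-- A radius of `x` is also one of `y`, so each point lies in the support of the other; the supports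
agree and injectivity on interiors applies. -/
theorem eq_of_proj_eq {i : X.Index} {x y : Cube (X.dim i)} (hxy : X.proj i x = X.proj i y) {r : ℝ}
    (hr : x.IsRadius r) (h : dist x y < r) : x = y := by
  refine X.injOn_interior i x y ?_ (glue_of_proj_eq hxy)
  refine Cube.support_eq_of_mem (hr.mem_support h).1 ?_
  rw [dist_comm] at h
  exact ((isRadius_of_proj_eq hxy hr).mem_support h).2

theorem edist_le_of_string {P Q : X.Point} {ℓ : ℝ≥0} (h : X.HasString P Q ℓ) :
    edist P Q ≤ ℓ := iInf₂_le ℓ h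

theorem edist_proj_le (i : X.Index) (a b : Cube (X.dim i)) :
    edist (X.proj i a) (X.proj i b) ≤ edist a b := by
  have h := edist_le_of_string (HasString.cons i a b _ 0 (.nil (X.proj i b)))
  rwa [add_zero, ← edist_nndist] at h

theorem d_proj_le (i : X.Index) (a b : Cube (X.dim i)) :
    X.d (X.proj i a) (X.proj i b) ≤ dist a b := by
  rw [dist_edist]
  exact ENNReal.toReal_mono (edist_ne_top _ _) (edist_proj_le i a b)

theorem d_comm (P Q : X.Point) : X.d P Q = X.d Q P := by rw [d, d, edist_comm]

theorem d_nonneg (P Q : X.Point) : 0 ≤ X.d P Q := ENNReal.toReal_nonneg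

theorem d_self (P : X.Point) : X.d P P = 0 := by simp [d]

theorem d_triangle (hX : IsCAT0 X.Point) (P Q R : X.Point) : X.d P R ≤ X.d P Q + X.d Q R := by
  rw [d, d, d, ← ENNReal.toReal_add (hX.edist_ne_top _ _) (hX.edist_ne_top _ _)]
  exact ENNReal.toReal_mono (ENNReal.add_ne_top.2 ⟨hX.edist_ne_top _ _, hX.edist_ne_top _ _⟩)
    (edist_triangle _ _ _)

theorem exists_string_of_d_lt (hX : IsCAT0 X.Point) {P Q : X.Point} {r : ℝ} (h : X.d P Q < r) :
    ∃ ℓ : ℝ≥0, X.HasString P Q ℓ ∧ (ℓ : ℝ) < r := by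
  have h1 : edist P Q < ENNReal.ofReal r :=
    (ENNReal.lt_ofReal_iff_toReal_lt (hX.edist_ne_top _ _)).2 h
  obtain ⟨ℓ, h2⟩ := iInf_lt_iff.1 h1
  obtain ⟨h3, h4⟩ := iInf_lt_iff.1 h2
  exact ⟨ℓ, h3, (ENNReal.lt_ofReal_iff_toReal_lt ENNReal.coe_ne_top).1 h4⟩

/-- A string shorter than the radius of `P` can be followed backwards: at every stage the lift of
`P` lies in the support of the current point, so the gluing isometry carries it, with its distance,
into any other cube. -/
theorem exists_lift_of_string {P Q : X.Point} {ℓ : ℝ≥0} (h : X.HasString Q P ℓ) {i : X.Index}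
    {x : Cube (X.dim i)} (hx : X.proj i x = P) {r : ℝ} (hr : x.IsRadius r) (hℓ : ℓ < r)
    {j : X.Index} {y : Cube (X.dim j)} (hy : X.proj j y = Q) :
    ∃ z : Cube (X.dim j), X.proj j z = P ∧ dist z y ≤ ℓ := by
  induction h generalizing j y with
  | nil Q => exact ⟨y, hy, by simp⟩
  | cons m a b P ℓ _ ih =>
    rw [NNReal.coe_add, coe_nndist] at hℓ
    obtain ⟨z, hz, hzb⟩ := ih hx (by linarith [dist_nonneg (x := a) (y := b)]) rfl
    have hza : dist z a ≤ dist a b + ℓ := by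
      linarith [dist_triangle z b a, dist_comm a b]
    have hzs := ((isRadius_of_proj_eq (hx.trans hz.symm) hr).mem_support (hza.trans_lt hℓ)).1
    obtain ⟨h, hh, ha⟩ := exists_isometry hy.symm
    refine ⟨(h ⟨z, hzs⟩).1, (hh _).symm.trans hz, ?_⟩
    have h1 : dist (h ⟨z, hzs⟩).1 (h ⟨a, a.self_mem_support⟩).1 = dist z a := h.dist_eq _ _
    rw [ha] at h1
    rw [h1, NNReal.coe_add, coe_nndist]
    exact hza

/-- Near a point `P`, every lift of `Q` is joined to a lift of `P` by a segment of length
`d P Q`. -/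
theorem exists_lift (hX : IsCAT0 X.Point)
    {P Q : X.Point} {i : X.Index} {x : Cube (X.dim i)} (hx : X.proj i x = P)
    {r : ℝ} (hr : x.IsRadius r) (h : X.d P Q < r / 2) {j : X.Index} {y : Cube (X.dim j)}
    (hy : X.proj j y = Q) : ∃ z : Cube (X.dim j), X.proj j z = P ∧ dist z y = X.d P Q := by
  have h0 := d_nonneg P Q
  rw [d_comm] at h
  obtain ⟨ℓ, hℓ, hℓr⟩ := exists_string_of_d_lt hX h
  obtain ⟨z, hz, hzy⟩ := exists_lift_of_string hℓ hx hr (by linarith) hy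
  refine ⟨z, hz, le_antisymm ?_ ?_⟩
  · refine le_of_forall_gt fun b hb => ?_
    rw [d_comm] at hb
    obtain ⟨ℓ', hℓ', hℓr'⟩ := exists_string_of_d_lt hX (lt_min hb h)
    rw [lt_min_iff] at hℓr'
    obtain ⟨z', hz', hzy'⟩ := exists_lift_of_string hℓ' hx hr (by linarith) hy
    -- Strings shorter than `r / 2` all produce the same lift, since two of them are less than `r`
    -- apart. So one lift realizes the infimum.
    have : z = z' := eq_of_proj_eq (hz.trans hz'.symm) (isRadius_of_proj_eq (hx.trans hz.symm) hr)
      (by linarith [dist_triangle_right z z' y])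
    rw [this]
    linarith
  · rw [← hz, ← hy]
    exact d_proj_le j z y

/-- The characteristic maps are isometries near each point. -/
theorem d_proj_eq (hX : IsCAT0 X.Point)
    {i : X.Index} {x a : Cube (X.dim i)} {r : ℝ} (hr : x.IsRadius r)
    (h : dist x a < r / 2) : X.d (X.proj i x) (X.proj i a) = dist x a := by
  have h1 := d_proj_le i x a
  obtain ⟨z, hz, hza⟩ := exists_lift hX rfl hr (h1.trans_lt h) (rfl : X.proj i a = _)
  have : x = z := eq_of_proj_eq hz.symm hr (by linarith [dist_triangle_right x z a])
  rw [← hza, ← this]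

theorem abs_d_sub_le (hX : IsCAT0 X.Point) (i : X.Index) (a b : Cube (X.dim i)) (v : X.Point) :
    |X.d (X.proj i a) v - X.d (X.proj i b) v| ≤ dist a b := by
  have h1 := d_triangle hX (X.proj i a) (X.proj i b) v
  have h2 := d_triangle hX (X.proj i b) (X.proj i a) v
  have h3 := d_proj_le i a b
  rw [d_comm] at h2
  rw [d_comm (X.proj i b) (X.proj i a)] at h2
  rw [d_comm v] at h2
  rw [abs_le]
  constructor <;> linarith

end CubeComplex

/-! ### Coordinate minima of the distance propagate along geodesics -/

namespace CubeComplex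

variable {X : CubeComplex.{u}}

/-- The distance to `v` has a local minimum at `x` along the `k`-th coordinate direction. -/
def IsCoordMin {i : X.Index} (x : Cube (X.dim i)) (k : Fin (X.dim i)) (v : X.Point) : Prop :=
  ∃ δ > 0, ∀ s : ℝ, |s| ≤ 1 / 2 → |s - x.1 k| < δ →
    X.d (X.proj i x) v ≤ X.d (X.proj i (x.upd k s)) v

theorem IsCoordMin.of_proj_eq {i j : X.Index} {x : Cube (X.dim i)} {y : Cube (X.dim j)}
    (hxy : X.proj i x = X.proj j y) {k : Fin (X.dim i)} (hk : k ∈ x.freeCoords) {v : X.Point}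
    (h : IsCoordMin x k v) :
    ∃ l ∈ y.freeCoords, X.Par ⟨i, k⟩ ⟨j, l⟩ ∧ IsCoordMin y l v := by
  obtain ⟨l, hl, τ, hτ, hkl, hs⟩ := exists_coord_of_proj_eq hxy hk
  refine ⟨l, hl, par_of_step ⟨x, y, τ, hτ, hs⟩, ?_⟩
  obtain ⟨δ, hδ, hδs⟩ := h
  refine ⟨δ, hδ, fun s hs1 hs2 => ?_⟩
  rw [hkl] at hs2
  have h1 : |τ * s| ≤ 1 / 2 := by rcases hτ with rfl | rfl <;> simpa using hs1
  have h2 : |τ * s - x.1 k| < δ := by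
    rcases hτ with rfl | rfl
    · simpa using hs2
    · rw [← abs_neg]
      convert hs2 using 2
      ring
  have h3 := hδs (τ * s) h1 h2
  have h4 : τ * (τ * s) = s := by rcases hτ with rfl | rfl <;> ring
  rwa [hs _ h1, h4, hxy] at h3

/-- The segment from `y` to `z` starts a shortest path to `v`. If it changed coordinate `l`, moving
`y` slightly in that direction would bring it closer to `v`. Otherwise, shifting both ends equally
in direction `l` does not lengthen the segment, so the triangle inequality passes the minimum on to
`z`. -/
theorem IsCoordMin.of_segment (hX : IsCAT0 X.Point)
    {i : X.Index} {y z : Cube (X.dim i)} {l : Fin (X.dim i)}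
    {v : X.Point} (h : IsCoordMin y l v)
    (hd : dist y z + X.d (X.proj i z) v = X.d (X.proj i y) v) :
    z.1 l = y.1 l ∧ IsCoordMin z l v := by
  obtain ⟨δ, hδ, hδs⟩ := h
  have heq : z.1 l = y.1 l := by
    by_contra hne
    -- Coordinates differ by at most one, so moving by the fraction `η` stays within `δ`.
    set η : ℝ := min (1 / 2) (δ / 2)
    have hη0 : 0 < η := by positivity
    have hη1 : η ≤ 1 / 2 := min_le_left _ _
    have hη2 : η ≤ δ / 2 := min_le_right _ _
    have hΔ : 0 < |y.1 l - z.1 l| := abs_pos.2 (sub_ne_zero.2 (Ne.symm hne))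
    have hΔ1 : |y.1 l - z.1 l| ≤ 1 := by
      have := Cube.sub_sq_le_one y z l
      exact (sq_le_one_iff_abs_le_one _).1 this
    have hs : |y.1 l + η * (z.1 l - y.1 l)| ≤ 1 / 2 := by
      have h1 := y.2 l
      have h2 := z.2 l
      rw [Set.mem_Icc] at h1 h2
      rw [abs_le]
      constructor <;> nlinarith
    have h1 := hδs _ hs (by
      rw [add_sub_cancel_left, abs_mul, abs_of_pos hη0, abs_sub_comm]
      nlinarith)
    have h2 : dist (y.upd l (y.1 l + η * (z.1 l - y.1 l))) z < dist y z := by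
      refine Cube.dist_upd_lt hs ?_
      have : y.1 l + η * (z.1 l - y.1 l) - z.1 l = (1 - η) * (y.1 l - z.1 l) := by ring
      rw [this, abs_mul, abs_of_pos (by linarith)]
      nlinarith
    have h3 := d_triangle hX (X.proj i (y.upd l (y.1 l + η * (z.1 l - y.1 l)))) (X.proj i z) v
    have h4 := d_proj_le i (y.upd l (y.1 l + η * (z.1 l - y.1 l))) z
    linarith
  refine ⟨heq, δ, hδ, fun s hs1 hs2 => ?_⟩
  rw [heq] at hs2
  have h1 := hδs s hs1 hs2
  have h2 := d_triangle hX (X.proj i (y.upd l s)) (X.proj i (z.upd l s)) v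
  have h3 := d_proj_le i (y.upd l s) (z.upd l s)
  have h4 := Cube.dist_upd_upd_le y z l s
  linarith

theorem d_geodesic {γ : ℝ → X.Point} {P Q : X.Point} (h : IsGeodesic γ P Q) {s t : ℝ}
    (hs : s ∈ Set.Icc (0 : ℝ) 1) (ht : t ∈ Set.Icc (0 : ℝ) 1) :
    X.d (γ s) (γ t) = |s - t| * X.d P Q := by
  rw [d, h.2.2 s hs t ht, ENNReal.toReal_mul, ENNReal.toReal_ofReal (abs_nonneg _), d]

theorem exists_proj_eq (P : X.Point) : ∃ (i : X.Index) (x : Cube (X.dim i)), X.proj i x = P := by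
  obtain ⟨⟨i, x⟩, rfl⟩ := Quotient.exists_rep P
  exact ⟨i, x, rfl⟩

/-- If the distance to `v` has a local minimum at `x` in the direction of the coordinate `k`, then
`v` has a free coordinate parallel to `k`. -/
theorem IsCoordMin.exists_par (hX : IsCAT0 X.Point)
    {i : X.Index} {x : Cube (X.dim i)} {k : Fin (X.dim i)}
    (hk : k ∈ x.freeCoords) {v : X.Point} (h : IsCoordMin x k v) :
    ∃ (j : X.Index) (y : Cube (X.dim j)) (l : Fin (X.dim j)), X.proj j y = v ∧
      l ∈ y.freeCoords ∧ X.Par ⟨i, k⟩ ⟨j, l⟩ := by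
  obtain ⟨γ, hγ⟩ := hX.exists_geodesic (X.proj i x) v
  set L := X.d (X.proj i x) v
  have hL : 0 ≤ L := d_nonneg _ _
  let A : Set ℝ := {t | t ∈ Set.Icc (0 : ℝ) 1 ∧ ∃ (j : X.Index) (y : Cube (X.dim j))
    (l : Fin (X.dim j)), X.proj j y = γ t ∧ l ∈ y.freeCoords ∧ X.Par ⟨i, k⟩ ⟨j, l⟩ ∧
      IsCoordMin y l v}
  have hend : ∀ {t}, t ∈ Set.Icc (0 : ℝ) 1 → X.d (γ t) v = (1 - t) * L := fun {t} ht => by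
    have := d_geodesic hγ ht (Set.right_mem_Icc.2 zero_le_one)
    rw [hγ.2.1, abs_sub_comm, abs_of_nonneg (by linarith [ht.2])] at this
    exact this
  have h0 : (0 : ℝ) ∈ A := ⟨by simp, i, x, k, hγ.1.symm, hk, X.Par.refl _, h⟩
  have hbdd : BddAbove A := ⟨1, fun t ht => ht.1.2⟩
  set T := sSup A
  have hT : T ∈ Set.Icc (0 : ℝ) 1 := ⟨le_csSup hbdd h0, csSup_le ⟨0, h0⟩ fun t ht => ht.1.2⟩
  obtain ⟨m, w, hw⟩ := exists_proj_eq (γ T)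
  obtain ⟨r, hr0, hr⟩ := w.exists_isRadius
  -- The summand `1` covers `L = 0`; times within `ε` of `T` give points within `r / 2` of `γ T`.
  set ε := r / 2 / (L + 1)
  have hε : 0 < ε := by positivity
  have hclose : ∀ {t}, t ∈ Set.Icc (0 : ℝ) 1 → |T - t| < ε → X.d (γ T) (γ t) < r / 2 :=
    fun {t} ht htε => by
      rw [d_geodesic hγ hT ht]
      calc |T - t| * L ≤ |T - t| * (L + 1) := by gcongr; linarith
        _ < ε * (L + 1) := by gcongr
        _ = r / 2 := by simp only [ε]; field_simp
  -- `A` contains its supremum: for nearby `t` in `A`, the point `γ T` lifts to the cube already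
  -- carrying the minimum at `γ t`.
  have hTA : T ∈ A := by
    obtain ⟨t, ht, hTt⟩ := exists_lt_of_lt_csSup ⟨0, h0⟩ (sub_lt_self T hε)
    have htT : t ≤ T := le_csSup hbdd ht
    obtain ⟨htI, j, y, l, hy, hl, hpar, hmin⟩ := ht
    obtain ⟨z, hz, hzy⟩ := exists_lift hX hw hr
      (hclose htI (by rw [abs_of_nonneg (by linarith)]; linarith)) hy
    obtain ⟨h1, h2⟩ := hmin.of_segment hX (z := z) (by
      rw [dist_comm, hzy, d_geodesic hγ hT htI, hz, hy, hend hT, hend htI,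
        abs_of_nonneg (by linarith)]
      ring)
    refine ⟨hT, j, z, l, hz, ?_, hpar, h2⟩
    rw [Cube.mem_freeCoords, h1]
    exact Cube.mem_freeCoords.1 hl
  rcases hT.2.eq_or_lt with hT1 | hT1
  · obtain ⟨-, j, y, l, hy, hl, hpar, -⟩ := hTA
    exact ⟨j, y, l, by rw [hy, hT1, hγ.2.1], hl, hpar⟩
  exfalso
  obtain ⟨-, j, y, l, hy, hl, hpar, hmin⟩ := hTA
  set t := min 1 (T + ε / 2)
  have htT : T < t := lt_min hT1 (by linarith)
  have ht : t ∈ Set.Icc (0 : ℝ) 1 := ⟨by linarith [hT.1], min_le_left _ _⟩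
  -- Beyond `T` the next cube may differ: take one containing `γ t`, lift `γ T` to it, transfer the
  -- minimum to that lift, and move on to `γ t`.
  obtain ⟨j', y', hy'⟩ := exists_proj_eq (γ t)
  obtain ⟨z, hz, hzy⟩ := exists_lift hX hw hr (hclose ht (by
    rw [abs_sub_comm, abs_of_nonneg (by linarith)]
    linarith [min_le_right 1 (T + ε / 2)])) hy'
  obtain ⟨l', hl', hpar', hmin'⟩ := hmin.of_proj_eq (hy.trans hz.symm) hl
  obtain ⟨h1, h2⟩ := hmin'.of_segment hX (z := y') (by
      rw [hzy, d_geodesic hγ hT ht, hz, hy', hend hT, hend ht, abs_sub_comm,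
        abs_of_nonneg (by linarith)]
      ring)
  have : t ∈ A := by
    refine ⟨ht, j', y', l', hy', ?_, X.Par.trans hpar hpar', h2⟩
    rw [Cube.mem_freeCoords, h1]
    exact Cube.mem_freeCoords.1 hl'
  linarith [le_csSup hbdd this]

end CubeComplex

/-- Euclidean triangles with given side lengths exist. -/
theorem exists_comparison_triangle {a b c : ℝ} (ha : 0 ≤ a) (hb : 0 ≤ b) (hc : 0 < c)
    (h1 : a ≤ b + c) (h2 : b ≤ a + c) (h3 : c ≤ a + b) :
    ∃ p q r : EuclideanSpace ℝ (Fin 2), dist p q = c ∧ dist p r = a ∧ dist q r = b := by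
  set s := (c ^ 2 + a ^ 2 - b ^ 2) / (2 * c)
  have hs : 2 * c * s = c ^ 2 + a ^ 2 - b ^ 2 := by simp only [s]; field_simp
  have hsa : 0 ≤ a ^ 2 - s ^ 2 := by
    have h4 : (2 * c) ^ 2 * (a ^ 2 - s ^ 2) =
        ((b - a + c) * (b + a - c)) * ((a + c - b) * (a + c + b)) := by
      have : (2 * c) ^ 2 * (a ^ 2 - s ^ 2) = (2 * c * a) ^ 2 - (2 * c * s) ^ 2 := by ring
      rw [this, hs]
      ring
    have h5 : 0 ≤ (2 * c) ^ 2 * (a ^ 2 - s ^ 2) := by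
      rw [h4]
      refine mul_nonneg (mul_nonneg ?_ ?_) (mul_nonneg ?_ ?_) <;> linarith
    exact nonneg_of_mul_nonneg_right h5 (by positivity)
  refine ⟨!₂[0, 0], !₂[c, 0], !₂[s, √(a ^ 2 - s ^ 2)], ?_, ?_, ?_⟩
  · simp [EuclideanSpace.dist_eq, Real.dist_eq, Real.sqrt_sq hc.le]
  · simp [EuclideanSpace.dist_eq, Real.dist_eq, sq_abs, Real.sq_sqrt hsa, ha]
  · simp only [EuclideanSpace.dist_eq, Real.dist_eq, sq_abs, Fin.sum_univ_two]
    simp only [Matrix.cons_val_zero, Matrix.cons_val_one, Matrix.cons_val_fin_one, zero_sub,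
      even_two, Even.neg_pow, Real.sq_sqrt hsa]
    have h4 : (c - s) ^ 2 + (a ^ 2 - s ^ 2) = b ^ 2 := by linear_combination -hs
    rw [h4, Real.sqrt_sq hb]

/-! ### Convexity of the distance and strict monotonicity in coordinates -/

namespace CubeComplex

variable {X : CubeComplex.{u}}

/-- A segment of a cube whose ends have their Euclidean distance in the complex is a geodesic, and
the distance to a point is convex along it. -/
theorem two_mul_d_le (hX : IsCAT0 X.Point) {i : X.Index} {x : Cube (X.dim i)} {k : Fin (X.dim i)}
    {s : ℝ} (hs0 : 0 < s) (h1 : |x.1 k - s| ≤ 1 / 2) (h2 : |x.1 k + s| ≤ 1 / 2)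
    (hd : X.d (X.proj i (x.upd k (x.1 k - s))) (X.proj i (x.upd k (x.1 k + s))) = 2 * s)
    (v : X.Point) :
    2 * X.d (X.proj i x) v ≤
      X.d (X.proj i (x.upd k (x.1 k - s))) v + X.d (X.proj i (x.upd k (x.1 k + s))) v := by
  set P := X.proj i (x.upd k (x.1 k - s))
  set Q := X.proj i (x.upd k (x.1 k + s))
  let f : ℝ → ℝ := fun t => x.1 k - s + t * (2 * s)
  let α : ℝ → X.Point := fun t => X.proj i (x.upd k (f t))
  have hf : ∀ t ∈ Set.Icc (0 : ℝ) 1, |f t| ≤ 1 / 2 := fun t ht => by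
    rw [abs_le] at h1 h2 ⊢
    have h3 := ht.1
    have h4 := ht.2
    constructor <;> simp only [f] <;> nlinarith
  have hle : ∀ t ∈ Set.Icc (0 : ℝ) 1, ∀ t' ∈ Set.Icc (0 : ℝ) 1,
      X.d (α t) (α t') ≤ |t - t'| * (2 * s) := fun t ht t' ht' => by
    refine (d_proj_le i _ _).trans ?_
    rw [Cube.dist_upd_upd x k (hf t ht) (hf t' ht')]
    have : f t - f t' = (t - t') * (2 * s) := by simp only [f]; ring
    rw [this, abs_mul, abs_of_pos (by linarith : (0 : ℝ) < 2 * s)]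
  have h0 : (0 : ℝ) ∈ Set.Icc (0 : ℝ) 1 := by simp
  have h1' : (1 : ℝ) ∈ Set.Icc (0 : ℝ) 1 := by simp
  have hα0 : α 0 = P := by simp [α, f, P]
  have hα1 : α 1 = Q := by simp only [α, f, Q]; congr 2; ring
  have heq' : ∀ t ∈ Set.Icc (0 : ℝ) 1, ∀ t' ∈ Set.Icc (0 : ℝ) 1, t ≤ t' →
      X.d (α t) (α t') = |t - t'| * (2 * s) := fun t ht t' ht' htt' => by
    refine le_antisymm (hle t ht t' ht') ?_
    have e1 := hle 0 h0 t ht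
    have e2 := hle t' ht' 1 h1'
    rw [hα0] at e1
    rw [hα1] at e2
    have e3 := d_triangle hX P (α t) Q
    have e4 := d_triangle hX (α t) (α t') Q
    rw [abs_sub_comm, abs_of_nonneg (by linarith)]
    rw [abs_sub_comm, abs_of_nonneg (by linarith [ht.1])] at e1
    rw [abs_sub_comm, abs_of_nonneg (by linarith [ht'.2])] at e2
    linarith
  have heq : ∀ t ∈ Set.Icc (0 : ℝ) 1, ∀ t' ∈ Set.Icc (0 : ℝ) 1,
      X.d (α t) (α t') = |t - t'| * (2 * s) := fun t ht t' ht' => by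
    rcases le_total t t' with h | h
    · exact heq' t ht t' ht' h
    · rw [d_comm, abs_sub_comm]
      exact heq' t' ht' t ht h
  have hofReal : ∀ R S : X.Point, edist R S = ENNReal.ofReal (X.d R S) := fun R S =>
    (ENNReal.ofReal_toReal (hX.edist_ne_top R S)).symm
  have hgeo : IsGeodesic α P Q := by
    refine ⟨hα0, hα1, fun t ht t' ht' => ?_⟩
    rw [hofReal, hofReal P Q, hd, heq t ht t' ht', ENNReal.ofReal_mul (abs_nonneg _)]
  obtain ⟨β, hβ⟩ := hX.exists_geodesic P v
  obtain ⟨p, q, r, hpq, hpr, hqr⟩ := exists_comparison_triangle (a := X.d P v) (b := X.d Q v)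
    (c := 2 * s) (d_nonneg _ _) (d_nonneg _ _) (by linarith)
    (by linarith [d_triangle hX P Q v]) (by linarith [d_triangle hX Q P v, d_comm Q P])
    (by linarith [d_triangle hX P v Q, d_comm Q v])
  -- Comparing the midpoint of one side with the opposite vertex `v`, the point at time `1` of the
  -- other side, reduces the claim to the Euclidean plane.
  have hcmp := hX.comparison P Q v α β hgeo hβ p q r
    (by rw [edist_dist, hpq, hofReal, hd]) (by rw [edist_dist, hpr, hofReal])
    (by rw [edist_dist, hqr, hofReal]) (1 / 2) ⟨by norm_num, by norm_num⟩ 1 h1'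
  have hαh : α (1 / 2) = X.proj i x := by
    simp only [α, f]
    have : x.1 k - s + 1 / 2 * (2 * s) = x.1 k := by ring
    rw [this, Cube.upd_eq_self]
  rw [hβ.2.1, hαh, AffineMap.lineMap_apply_one, hofReal, edist_dist,
    ENNReal.ofReal_le_ofReal_iff dist_nonneg] at hcmp
  have hmid : dist (AffineMap.lineMap p q (1 / 2 : ℝ)) r ≤ (dist p r + dist q r) / 2 := by
    have := dist_midpoint_midpoint_le p q r r
    rw [midpoint_self, midpoint, invOf_eq_inv, ← one_div] at this
    exact this
  rw [hpr, hqr] at hmid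
  linarith

/-- If two points of a cube that differ in the `k`-th coordinate only have the same distance to `v`,
then `v` has a free coordinate parallel to `k`. -/
theorem exists_par_of_d_eq (hX : IsCAT0 X.Point) {i : X.Index} (x : Cube (X.dim i))
    (k : Fin (X.dim i)) {s t : ℝ} (hs : -(1 / 2) < s) (hst : s < t) (ht : t < 1 / 2) {v : X.Point}
    (hd : X.d (X.proj i (x.upd k s)) v = X.d (X.proj i (x.upd k t)) v) :
    ∃ (j : X.Index) (y : Cube (X.dim j)) (l : Fin (X.dim j)), X.proj j y = v ∧
      l ∈ y.freeCoords ∧ X.Par ⟨i, k⟩ ⟨j, l⟩ := by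
  have habs : ∀ a ∈ Set.Icc s t, |a| ≤ 1 / 2 := fun a ha =>
    abs_le.2 ⟨by linarith [ha.1], by linarith [ha.2]⟩
  have hcont : ContinuousOn (fun a => X.d (X.proj i (x.upd k a)) v) (Set.Icc s t) := by
    refine (LipschitzOnWith.of_dist_le_mul (K := 1) fun a ha b hb => ?_).continuousOn
    rw [NNReal.coe_one, one_mul, Real.dist_eq, Real.dist_eq,
      ← Cube.dist_upd_upd x k (habs a ha) (habs b hb)]
    exact abs_d_sub_le hX i _ _ v
  obtain ⟨a, ha, hext⟩ := exists_isLocalExtr_Ioo hst hcont hd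
  set y := x.upd k a
  have hya : y.1 k = a := Cube.upd_self x k (habs a ⟨ha.1.le, ha.2.le⟩)
  have hyu : ∀ b, y.upd k b = x.upd k b := fun b => Cube.upd_upd x k a b
  have hky : k ∈ y.freeCoords := by
    refine Cube.mem_freeCoords_of_abs_lt ?_
    rw [hya, abs_lt]
    exact ⟨by linarith [ha.1], by linarith [ha.2]⟩
  refine IsCoordMin.exists_par hX hky ?_
  rcases hext with hmin | hmax
  · obtain ⟨δ, hδ, h⟩ := Metric.eventually_nhds_iff.1 hmin
    refine ⟨δ, hδ, fun b _ hb => ?_⟩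
    rw [hyu]
    rw [hya] at hb
    exact h hb
  · obtain ⟨δ, hδ, h⟩ := Metric.eventually_nhds_iff.1 hmax
    obtain ⟨r, hr0, hr⟩ := y.exists_isRadius
    -- After a shift by `σ` the radius is still `r - σ`, and the segment of length `2 * σ` must be
    -- shorter than half of it; this is `5 * σ < r`. Then convexity along the segment forces
    -- equality at the local maximum, which becomes a local minimum.
    refine ⟨min δ (r / 5), by positivity, fun b hb1 hb => ?_⟩
    rw [hya, lt_min_iff] at hb
    rcases eq_or_ne b a with rfl | hba
    · rw [hyu]
    set σ := |b - a|
    have hσ : 0 < σ := abs_pos.2 (sub_ne_zero.2 hba)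
    have hra := hr.2 k hky
    rw [hya] at hra
    have hr1 : |a - σ| ≤ 1 / 2 := by
      have := abs_sub a σ
      rw [abs_of_pos hσ] at this
      linarith
    have hr2 : |a + σ| ≤ 1 / 2 := by
      have := abs_add_le a σ
      rw [abs_of_pos hσ] at this
      linarith
    have hdist : dist (y.upd k (a - σ)) (y.upd k (a + σ)) = 2 * σ := by
      rw [Cube.dist_upd_upd y k hr1 hr2, abs_sub_comm, abs_of_nonneg (by linarith)]
      ring
    have hrad : (y.upd k (a - σ)).IsRadius (r - σ) := by
      refine ⟨by linarith [hr.1], fun l hl => ?_⟩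
      rcases eq_or_ne l k with rfl | hlk
      · rw [Cube.upd_self y l hr1]
        have := abs_sub a σ
        rw [abs_of_pos hσ] at this
        linarith
      · rw [Cube.mem_freeCoords, Cube.upd_of_ne _ _ hlk] at hl
        rw [Cube.upd_of_ne _ _ hlk]
        linarith [hr.2 l (Cube.mem_freeCoords.2 hl)]
    have hd2 : X.d (X.proj i (y.upd k (a - σ))) (X.proj i (y.upd k (a + σ))) = 2 * σ := by
      rw [d_proj_eq hX hrad (by rw [hdist]; linarith), hdist]
    have hconv := two_mul_d_le hX (x := y) (k := k) hσ (by rwa [hya]) (by rwa [hya])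
      (by rwa [hya]) v
    rw [hya] at hconv
    have hm1 : X.d (X.proj i (x.upd k (a - σ))) v ≤ X.d (X.proj i y) v :=
      h (y := a - σ) (by rw [Real.dist_eq, sub_sub_cancel_left, abs_neg, abs_of_pos hσ]; exact hb.1)
    have hm2 : X.d (X.proj i (x.upd k (a + σ))) v ≤ X.d (X.proj i y) v :=
      h (y := a + σ) (by rw [Real.dist_eq, add_sub_cancel_left, abs_of_pos hσ]; exact hb.1)
    rw [hyu, hyu] at hconv
    rw [hyu]
    rcases abs_cases (b - a) with ⟨hc, -⟩ | ⟨hc, -⟩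
    · have : b = a + σ := by linarith
      rw [this]; linarith
    · have : b = a - σ := by linarith
      rw [this]; linarith

end CubeComplex

/-! ### Continuity of coordinate changes, and corners of cubes -/

namespace Cube

variable {n : ℕ}

theorem continuous_upd (k : Fin n) : Continuous fun p : Cube n × ℝ => p.1.upd k p.2 := by
  refine Continuous.subtype_mk ?_ _
  refine (PiLp.continuous_toLp 2 _).comp (continuous_pi fun i => ?_)
  split_ifs
  · fun_prop
  · exact ((EuclideanSpace.proj i : EuclideanSpace ℝ (Fin n) →L[ℝ] ℝ).continuous.comp
      continuous_subtype_val).comp continuous_fst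

instance preconnectedSpace : PreconnectedSpace (Cube n) := by
  refine Subtype.preconnectedSpace (Convex.isPreconnected ?_)
  intro x hx y hy a b ha hb hab i
  exact convex_Icc _ _ (hx i) (hy i) ha hb hab

/-- The centre of the cube. -/
noncomputable def center (n : ℕ) : Cube n := ⟨0, fun _ => by constructor <;> norm_num⟩

theorem eq_half_or_of_corner {c : Cube n} (hc : c.freeCoords = ∅) (k : Fin n) :
    c.1 k = 1 / 2 ∨ c.1 k = -(1 / 2) := by
  have h : k ∉ c.freeCoords := by simp [hc]
  rw [mem_freeCoords, not_not] at h
  exact eq_or_eq_neg_of_abs_eq h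

/-- The point `c` reflected in its `k`-th coordinate. -/
noncomputable def flip (c : Cube n) (k : Fin n) : Cube n := c.upd k (-c.1 k)

theorem flip_apply_self (c : Cube n) (k : Fin n) : (c.flip k).1 k = -c.1 k :=
  upd_self c k (by rw [abs_neg]; exact c.abs_le k)

theorem flip_apply_of_ne (c : Cube n) {k i : Fin n} (h : i ≠ k) : (c.flip k).1 i = c.1 i :=
  upd_of_ne c _ h

theorem flip_corner {c : Cube n} (hc : c.freeCoords = ∅) (k : Fin n) :
    (c.flip k).freeCoords = ∅ := by
  refine Finset.eq_empty_of_forall_notMem fun i hi => ?_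
  have h : i ∉ c.freeCoords := by simp [hc]
  rw [mem_freeCoords, not_not] at h
  rw [mem_freeCoords] at hi
  by_cases hik : i = k
  · subst hik
    rw [flip_apply_self, abs_neg] at hi
    exact hi h
  · rw [flip_apply_of_ne _ hik] at hi
    exact hi h

theorem freeCoords_upd_subset {c : Cube n} (hc : c.freeCoords = ∅) (k : Fin n) (s : ℝ) :
    (c.upd k s).freeCoords ⊆ {k} := by
  intro i hi
  by_contra hik
  rw [Finset.mem_singleton] at hik
  rw [mem_freeCoords, upd_of_ne _ _ hik] at hi
  have : i ∈ c.freeCoords := mem_freeCoords.2 hi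
  simp [hc] at this

end Cube

/-! ### Hyperplanes and their two sides -/

namespace CubeComplex

variable {X : CubeComplex.{u}}

/-- The point `v` has no free coordinate parallel to `c`. -/
def Avoids (v : X.Point) (c : Σ i : X.Index, Fin (X.dim i)) : Prop :=
  ∀ (j : X.Index) (y : Cube (X.dim j)) (l : Fin (X.dim j)), X.proj j y = v → l ∈ y.freeCoords →
    ¬ X.Par c ⟨j, l⟩

theorem avoids_of_freeCoords_subset {j : X.Index} {x : Cube (X.dim j)} {l : Fin (X.dim j)}
    (hx : x.freeCoords ⊆ {l}) {c : Σ i : X.Index, Fin (X.dim i)} (h : ¬ X.Par c ⟨j, l⟩) :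
    Avoids (X.proj j x) c := by
  intro m y n hy hn hc
  obtain ⟨l', hl', τ, hτ, -, hs⟩ := exists_coord_of_proj_eq hy hn
  obtain rfl := Finset.mem_singleton.1 (hx hl')
  exact h (X.Par.trans hc (par_of_step ⟨y, x, τ, hτ, hs⟩))

theorem freeCoords_eq_empty_of_proj_eq {i j : X.Index} {x : Cube (X.dim i)} {y : Cube (X.dim j)}
    (hxy : X.proj i x = X.proj j y) (hy : y.freeCoords = ∅) : x.freeCoords = ∅ := by
  refine Finset.eq_empty_of_forall_notMem fun k hk => ?_
  obtain ⟨l, hl, -⟩ := exists_coord_of_proj_eq hxy hk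
  simp [hy] at hl

theorem avoids_of_corner {j : X.Index} {x : Cube (X.dim j)} (hx : x.freeCoords = ∅)
    (c : Σ i : X.Index, Fin (X.dim i)) : Avoids (X.proj j x) c := by
  intro m y n hy hn
  rw [freeCoords_eq_empty_of_proj_eq hy hx] at hn
  simp at hn

/-- The point `v` lies on the negative side of the hyperplane dual to the coordinate `c`. -/
def IsNeg (v : X.Point) (c : Σ i : X.Index, Fin (X.dim i)) : Prop :=
  X.d (X.proj c.1 ((Cube.center _).upd c.2 (-(1 / 4)))) v <
    X.d (X.proj c.1 ((Cube.center _).upd c.2 (1 / 4))) v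

theorem continuous_d_proj (hX : IsCAT0 X.Point) (i : X.Index) (v : X.Point) :
    Continuous fun x : Cube (X.dim i) => X.d (X.proj i x) v := by
  refine (LipschitzWith.of_dist_le_mul (K := 1) fun a b => ?_).continuous
  rw [NNReal.coe_one, one_mul, Real.dist_eq]
  exact abs_d_sub_le hX i a b v

theorem continuous_d_upd (hX : IsCAT0 X.Point)
    (i : X.Index) (k : Fin (X.dim i)) (v : X.Point) {Y : Type*}
    [TopologicalSpace Y] {f : Y → Cube (X.dim i)} {g : Y → ℝ} (hf : Continuous f)
    (hg : Continuous g) : Continuous fun y => X.d (X.proj i ((f y).upd k (g y))) v := by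
  have h1 : Continuous fun y => (f y).upd k (g y) :=
    Continuous.comp (g := fun p : Cube (X.dim i) × ℝ => p.1.upd k p.2) (f := fun y => (f y, g y))
      (Cube.continuous_upd k) (hf.prodMk hg)
  exact Continuous.comp (g := fun x : Cube (X.dim i) => X.d (X.proj i x) v)
    (continuous_d_proj hX i v) h1

/-- The triples of a base point and two interior values `s < t` form a connected set, on which the
difference of distances never vanishes; so its sign is constant. -/
theorem d_lt_imp_of_avoids (hX : IsCAT0 X.Point) {i : X.Index} {k : Fin (X.dim i)} {v : X.Point}
    (hv : Avoids v ⟨i, k⟩) (x x' : Cube (X.dim i)) {s t s' t' : ℝ} (hs : -(1 / 2) < s)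
    (hst : s < t) (ht : t < 1 / 2) (hs' : -(1 / 2) < s') (hst' : s' < t') (ht' : t' < 1 / 2)
    (h : X.d (X.proj i (x.upd k s)) v < X.d (X.proj i (x.upd k t)) v) :
    X.d (X.proj i (x'.upd k s')) v < X.d (X.proj i (x'.upd k t')) v := by
  by_contra! hcon
  let A : Set (ℝ × ℝ) := {p | -(1 / 2) < p.1 ∧ p.1 < p.2 ∧ p.2 < 1 / 2}
  have hA : IsPreconnected A := by
    refine Convex.isPreconnected ?_
    rintro ⟨p1, p2⟩ hp ⟨q1, q2⟩ hq a b ha hb hab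
    simp only [A, Set.mem_ofPred_eq, Prod.smul_mk, Prod.mk_add_mk, smul_eq_mul] at hp hq ⊢
    rcases ha.eq_or_lt with rfl | ha'
    · obtain rfl : b = 1 := by linarith
      simpa using hq
    · obtain rfl : b = 1 - a := by linarith
      refine ⟨?_, ?_, ?_⟩ <;> nlinarith
  have hpre : IsPreconnected ((Set.univ : Set (Cube (X.dim i))) ×ˢ A) :=
    isPreconnected_univ.prod hA
  let g : Cube (X.dim i) × (ℝ × ℝ) → ℝ := fun p =>
    X.d (X.proj i (p.1.upd k p.2.2)) v - X.d (X.proj i (p.1.upd k p.2.1)) v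
  have hg : Continuous g :=
    (continuous_d_upd hX i k v continuous_fst (continuous_snd.comp continuous_snd)).sub
      (continuous_d_upd hX i k v continuous_fst (continuous_fst.comp continuous_snd))
  obtain ⟨⟨z, a, b⟩, hz, hz0⟩ := hpre.intermediate_value (a := (x', s', t')) (b := (x, s, t))
    ⟨trivial, hs', hst', ht'⟩ ⟨trivial, hs, hst, ht⟩ hg.continuousOn
    (show (0 : ℝ) ∈ _ from ⟨sub_nonpos.2 hcon, (sub_pos.2 h).le⟩)
  obtain ⟨j, y, l, hy, hl, hpar⟩ := exists_par_of_d_eq hX z k hz.2.1 hz.2.2.1 hz.2.2.2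
    (sub_eq_zero.1 hz0).symm
  exact hv j y l hy hl hpar

theorem isNeg_iff (hX : IsCAT0 X.Point)
    {i : X.Index} {k : Fin (X.dim i)} {v : X.Point} (hv : Avoids v ⟨i, k⟩)
    (x : Cube (X.dim i)) {s t : ℝ} (hs : -(1 / 2) < s) (hst : s < t) (ht : t < 1 / 2) :
    IsNeg v ⟨i, k⟩ ↔ X.d (X.proj i (x.upd k s)) v < X.d (X.proj i (x.upd k t)) v :=
  ⟨d_lt_imp_of_avoids hX hv _ _ (by norm_num) (by norm_num) (by norm_num) hs hst ht,
    d_lt_imp_of_avoids hX hv _ _ hs hst ht (by norm_num) (by norm_num) (by norm_num)⟩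

theorem d_ne_of_avoids (hX : IsCAT0 X.Point)
    {i : X.Index} {k : Fin (X.dim i)} {v : X.Point} (hv : Avoids v ⟨i, k⟩)
    (x : Cube (X.dim i)) {s t : ℝ} (hs : -(1 / 2) < s) (hst : s < t) (ht : t < 1 / 2) :
    X.d (X.proj i (x.upd k s)) v ≠ X.d (X.proj i (x.upd k t)) v := fun h => by
  obtain ⟨j, y, l, hy, hl, hpar⟩ := exists_par_of_d_eq hX x k hs hst ht h
  exact hv j y l hy hl hpar

/-- An identification with `τ = -1` swaps the sides, but for both points at once. Only the relation
of being on the same side is an invariant of the class. -/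
theorem isNeg_step (hX : IsCAT0 X.Point)
    {c c' : Σ i : X.Index, Fin (X.dim i)} (h : X.Step c c') {p q : X.Point}
    (hp : ∀ c, Avoids p c) (hq : ∀ c, Avoids q c) :
    (IsNeg p c ↔ IsNeg q c) ↔ (IsNeg p c' ↔ IsNeg q c') := by
  obtain ⟨i, k⟩ := c
  obtain ⟨j, l⟩ := c'
  obtain ⟨x, y, τ, hτ, hs⟩ := h
  have h1 := hs (-(1 / 4)) (by norm_num [abs_of_pos])
  have h2 := hs (1 / 4) (by norm_num [abs_of_pos])
  have key : ∀ v : X.Point, (∀ c, Avoids v c) → (IsNeg v ⟨i, k⟩ ↔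
      X.d (X.proj j (y.upd l (τ * -(1 / 4)))) v < X.d (X.proj j (y.upd l (τ * (1 / 4)))) v) :=
    fun v hv => by
      rw [isNeg_iff hX (hv _) x (s := -(1 / 4)) (t := 1 / 4) (by norm_num) (by norm_num)
        (by norm_num)]
      exact iff_of_eq (by rw [h1, h2])
  have key' : ∀ v : X.Point, (∀ c, Avoids v c) → (IsNeg v ⟨j, l⟩ ↔
      X.d (X.proj j (y.upd l (-(1 / 4)))) v < X.d (X.proj j (y.upd l (1 / 4))) v) :=
    fun v hv => isNeg_iff hX (hv _) y (by norm_num) (by norm_num) (by norm_num)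
  have hne : ∀ v : X.Point, (∀ c, Avoids v c) →
      X.d (X.proj j (y.upd l (-(1 / 4)))) v ≠ X.d (X.proj j (y.upd l (1 / 4))) v :=
    fun v hv => d_ne_of_avoids hX (hv _) y (by norm_num) (by norm_num) (by norm_num)
  rcases hτ with rfl | rfl
  · have e : ∀ v : X.Point, (∀ c, Avoids v c) → (IsNeg v ⟨i, k⟩ ↔ IsNeg v ⟨j, l⟩) :=
      fun v hv => by rw [key v hv, key' v hv, one_mul, one_mul]
    rw [e p hp, e q hq]
  · have e : ∀ v : X.Point, (∀ c, Avoids v c) → (IsNeg v ⟨i, k⟩ ↔ ¬ IsNeg v ⟨j, l⟩) :=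
      fun v hv => by
        rw [key v hv, key' v hv, neg_one_mul, neg_one_mul, neg_neg, not_lt]
        exact ⟨le_of_lt, fun h => lt_of_le_of_ne h (hne v hv).symm⟩
    rw [e p hp, e q hq, not_iff_not]

theorem isNeg_par (hX : IsCAT0 X.Point)
    {c c' : Σ i : X.Index, Fin (X.dim i)} (h : X.Par c c') {p q : X.Point}
    (hp : ∀ c, Avoids p c) (hq : ∀ c, Avoids q c) :
    (IsNeg p c ↔ IsNeg q c) ↔ (IsNeg p c' ↔ IsNeg q c') := by
  induction h with
  | rel c c' h => exact isNeg_step hX h hp hq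
  | refl => rfl
  | symm c c' _ ih => exact ih.symm
  | trans a b c _ _ ih1 ih2 => exact ih1.trans ih2

/-- A corner has radius one, so within distance `1/2` of it the complex and the cube have the same
distances to it, and these can be compared explicitly. -/
theorem isNeg_corner (hX : IsCAT0 X.Point)
    {i : X.Index} {c : Cube (X.dim i)} (hc : c.freeCoords = ∅)
    (k : Fin (X.dim i)) : IsNeg (X.proj i c) ⟨i, k⟩ ↔ c.1 k = -(1 / 2) := by
  have hd : ∀ s : ℝ, |s| ≤ 1 / 2 → |s - c.1 k| < 1 / 2 →
      X.d (X.proj i (c.upd k s)) (X.proj i c) = |s - c.1 k| := fun s hs hsc => by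
    rw [d_comm, d_proj_eq hX (Cube.isRadius_one hc), dist_comm, Cube.dist_upd_self c k hs]
    rwa [dist_comm, Cube.dist_upd_self c k hs]
  rcases Cube.eq_half_or_of_corner hc k with h | h
  · rw [h] at hd ⊢
    rw [isNeg_iff hX (avoids_of_corner hc _) c (s := 1 / 4) (t := 3 / 8) (by norm_num)
      (by norm_num) (by norm_num), hd, hd] <;> norm_num [abs_of_pos, abs_of_neg]
  · rw [h] at hd ⊢
    rw [isNeg_iff hX (avoids_of_corner hc _) c (s := -(3 / 8)) (t := -(1 / 4)) (by norm_num)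
      (by norm_num) (by norm_num), hd, hd] <;> norm_num [abs_of_pos, abs_of_neg]

/-- The hyperplane dual to an edge is the only one that separates the ends of the edge. -/
theorem isNeg_flip (hX : IsCAT0 X.Point) {i : X.Index} {c : Cube (X.dim i)} (hc : c.freeCoords = ∅)
    (k : Fin (X.dim i)) (e : Σ i : X.Index, Fin (X.dim i)) :
    (IsNeg (X.proj i c) e ↔ IsNeg (X.proj i (c.flip k)) e) ↔ ¬ X.Par e ⟨i, k⟩ := by
  constructor
  · intro h hpar
    rw [isNeg_par hX hpar (avoids_of_corner hc) (avoids_of_corner (Cube.flip_corner hc k)),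
      isNeg_corner hX hc, isNeg_corner hX (Cube.flip_corner hc k), Cube.flip_apply_self] at h
    rcases Cube.eq_half_or_of_corner hc k with h1 | h1 <;> rw [h1] at h <;> norm_num at h
  · intro hpar
    have hav : ∀ s : ℝ, Avoids (X.proj i (c.upd k s)) e := fun s =>
      avoids_of_freeCoords_subset (Cube.freeCoords_upd_subset hc k s) hpar
    obtain ⟨j, l⟩ := e
    -- Here the vertex moves along the edge and the hyperplane stays. No point of the edge has a
    -- free coordinate parallel to `e`, so `g` never vanishes and keeps its sign.
    let g : ℝ → ℝ := fun s =>
      X.d (X.proj j ((Cube.center _).upd l (1 / 4))) (X.proj i (c.upd k s)) -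
        X.d (X.proj j ((Cube.center _).upd l (-(1 / 4)))) (X.proj i (c.upd k s))
    have hg : Continuous g := by
      have h1 : ∀ P : X.Point, Continuous fun s : ℝ => X.d P (X.proj i (c.upd k s)) := fun P => by
        simp only [d_comm P]
        exact continuous_d_upd hX i k P continuous_const continuous_id
      exact (h1 _).sub (h1 _)
    have hg0 : ∀ s, g s ≠ 0 := fun s h => d_ne_of_avoids hX (hav s) (Cube.center _)
      (by norm_num) (by norm_num) (by norm_num) (sub_eq_zero.1 h).symm
    have hneg : ∀ s, IsNeg (X.proj i (c.upd k s)) ⟨j, l⟩ ↔ 0 < g s := fun s => sub_pos.symm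
    have hall : ∀ s t, 0 < g s → 0 < g t := fun s t hs => by
      by_contra! ht
      obtain ⟨r, hr⟩ := mem_range_of_exists_le_of_exists_ge hg ⟨t, ht⟩ ⟨s, hs.le⟩
      exact hg0 r hr
    conv_lhs => rw [← Cube.upd_eq_self c k]
    rw [Cube.flip, hneg, hneg]
    exact ⟨hall _ _, hall _ _⟩

theorem Vertex.exists_corner (x : X.Vertex) :
    ∃ (i : X.Index) (c : Cube (X.dim i)), c.freeCoords = ∅ ∧ X.proj i c = x.1 := by
  obtain ⟨x, i, a, ha, hS⟩ := x
  refine ⟨i, a, Finset.card_eq_zero.1 ha, ?_⟩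
  have : X.proj i a ∈ ({x} : Set X.Point) := hS ▸ ⟨a, a.self_mem_support, rfl⟩
  exact this

theorem isCell_corner {i : X.Index} {c : Cube (X.dim i)} (hc : c.freeCoords = ∅) :
    X.IsCell 0 {X.proj i c} := by
  refine ⟨i, c, Finset.card_eq_zero.2 hc, ?_⟩
  have : c.support = {c} := by
    ext z
    refine ⟨fun h => Cube.ext_coord fun l => h l (by simp [hc]), ?_⟩
    rintro rfl
    exact Cube.self_mem_support _
  rw [this, Set.image_singleton]

/-- The vertex of the complex that a corner of a cube represents. -/
def vertexOf (i : X.Index) (c : Cube (X.dim i)) (hc : c.freeCoords = ∅) : X.Vertex :=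
  ⟨X.proj i c, isCell_corner hc⟩

theorem adj_flip {i : X.Index} {c : Cube (X.dim i)} (hc : c.freeCoords = ∅)
    (k : Fin (X.dim i)) (hne : X.proj i c ≠ X.proj i (c.flip k)) :
    X.oneSkeleton.Adj (vertexOf i c hc) (vertexOf i (c.flip k) (Cube.flip_corner hc k)) := by
  refine ⟨fun h => hne (congrArg Subtype.val h), X.proj i '' (c.upd k 0).support,
    ⟨i, c.upd k 0, ?_, rfl⟩, ⟨c, ?_, rfl⟩, ⟨c.flip k, ?_, rfl⟩⟩
  all_goals
    have hk : (c.upd k 0).freeCoords = {k} := by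
      refine Finset.Subset.antisymm (Cube.freeCoords_upd_subset hc k 0) ?_
      rw [Finset.singleton_subset_iff, Cube.mem_freeCoords, Cube.upd_self c k (by simp)]
      norm_num
  · rw [hk, Finset.card_singleton]
  · intro l hl
    rw [hk, Finset.mem_singleton] at hl
    rw [Cube.upd_of_ne _ _ hl]
  · intro l hl
    rw [hk, Finset.mem_singleton] at hl
    rw [Cube.upd_of_ne _ _ hl, Cube.flip_apply_of_ne _ hl]

theorem exists_flip_of_adj {x y : X.Vertex} (h : X.oneSkeleton.Adj x y) :
    ∃ (i : X.Index) (c : Cube (X.dim i)) (k : Fin (X.dim i)), c.freeCoords = ∅ ∧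
      X.proj i c = x.1 ∧ X.proj i (c.flip k) = y.1 := by
  obtain ⟨hne, e, ⟨i, a, ha, rfl⟩, ⟨c, hc, hcx⟩, ⟨c', hc', hcy⟩⟩ := h
  obtain ⟨k, hk⟩ := Finset.card_eq_one.1 ha
  have corner : ∀ (v : X.Vertex) (b : Cube (X.dim i)), X.proj i b = v.1 → b.freeCoords = ∅ :=
    fun v b hb => by
      obtain ⟨j, p, hp, hpv⟩ := v.exists_corner
      exact freeCoords_eq_empty_of_proj_eq (hb.trans hpv.symm) hp
  refine ⟨i, c, k, corner x c hcx, hcx, ?_⟩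
  rw [← hcy]
  congr 1
  have hoff : ∀ l, l ≠ k → c.1 l = c'.1 l := fun l hl => by
    rw [hc l (by simpa [hk] using hl), hc' l (by simpa [hk] using hl)]
  have hcc : c.1 k ≠ c'.1 k := fun h => hne (Subtype.ext (by
    rw [← hcx, ← hcy]
    congr 1
    refine Cube.ext_coord fun l => ?_
    by_cases hl : l = k
    · rw [hl, h]
    · exact hoff l hl))
  refine Cube.ext_coord fun l => ?_
  by_cases hl : l = k
  · rw [hl, Cube.flip_apply_self]
    rcases Cube.eq_half_or_of_corner (corner x c hcx) k with h1 | h1 <;>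
      rcases Cube.eq_half_or_of_corner (corner y c' hcy) k with h2 | h2 <;>
      rw [h1, h2] at hcc ⊢ <;> first | exact absurd rfl hcc | norm_num
  · rw [Cube.flip_apply_of_ne _ hl, hoff l hl]

theorem proj_flip_ne (hX : IsCAT0 X.Point)
    {i : X.Index} {c : Cube (X.dim i)} (hc : c.freeCoords = ∅)
    (k : Fin (X.dim i)) : X.proj i c ≠ X.proj i (c.flip k) := fun h =>
  (isNeg_flip hX hc k ⟨i, k⟩).1 (by rw [h]) (X.Par.refl _)

/-- The first edge of a suitable edge path from `x` to `y` is dual to a hyperplane that separates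
`x` and `y`. -/
theorem exists_flip_separating (hX : IsCAT0 X.Point) {x y : X.Vertex} (hxy : x ≠ y) :
    ∃ (i : X.Index) (c : Cube (X.dim i)) (k : Fin (X.dim i)), c.freeCoords = ∅ ∧
      X.proj i c = x.1 ∧ ¬ (IsNeg x.1 ⟨i, k⟩ ↔ IsNeg y.1 ⟨i, k⟩) := by
  obtain ⟨γ, hγ⟩ := hX.exists_geodesic x.1 y.1
  obtain ⟨i₀, c₀, hc₀, hcx₀⟩ := x.exists_corner
  obtain ⟨j₀, p₀, hp₀, hpy₀⟩ := y.exists_corner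
  set L := X.d x.1 y.1
  have hL : 0 < L := by
    refine lt_of_le_of_ne (d_nonneg _ _) fun h => hxy (Subtype.ext ?_)
    refine hX.eq_of_edist_eq_zero _ _ ?_
    exact ((ENNReal.toReal_eq_zero_iff _).1 h.symm).resolve_right (hX.edist_ne_top _ _)
  -- This keeps `γ t` within `1/4` of `x`: close enough to lift the corner to its cube, and to keep
  -- the coordinates of `w` away from the opposite faces.
  set t : ℝ := min 1 (1 / 4 / L)
  have ht0 : 0 < t := by positivity
  have ht : t ∈ Set.Icc (0 : ℝ) 1 := ⟨ht0.le, min_le_left _ _⟩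
  have htL : t * L ≤ 1 / 4 := by
    calc t * L ≤ 1 / 4 / L * L := by gcongr; exact min_le_right _ _
      _ = 1 / 4 := by field_simp
  have hd0 : X.d x.1 (γ t) = t * L := by
    have := d_geodesic hγ (Set.left_mem_Icc.2 zero_le_one) ht
    rwa [hγ.1, zero_sub, abs_neg, abs_of_pos ht0] at this
  have hd1 : X.d (γ t) y.1 = (1 - t) * L := by
    have := d_geodesic hγ ht (Set.right_mem_Icc.2 zero_le_one)
    rwa [hγ.2.1, abs_sub_comm, abs_of_nonneg (by linarith [ht.2])] at this
  obtain ⟨i, w, hw⟩ := exists_proj_eq (γ t)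
  obtain ⟨c, hcx, hcw⟩ := exists_lift hX hcx₀ (Cube.isRadius_one hc₀)
    (by rw [hd0]; linarith) hw
  have hc : c.freeCoords = ∅ := freeCoords_eq_empty_of_proj_eq (hcx.trans hcx₀.symm) hc₀
  rw [hd0] at hcw
  obtain ⟨k, hk⟩ : ∃ k, c.1 k ≠ w.1 k := by
    by_contra! h
    rw [Cube.ext_coord h, dist_self] at hcw
    exact (mul_pos ht0 hL).ne hcw
  refine ⟨i, c, k, hc, hcx, ?_⟩
  have hav : Avoids y.1 ⟨i, k⟩ := by
    rw [← hpy₀]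
    exact avoids_of_corner hp₀ _
  have hck : |c.1 k - w.1 k| ≤ 1 / 4 := (Cube.abs_sub_le_dist c w k).trans (by linarith)
  rw [abs_le] at hck
  -- the midpoint of `c` and `w`
  let z : Cube (X.dim i) := ⟨midpoint ℝ c.1 w.1, fun l => by
    have h1 := c.2 l
    have h2 := w.2 l
    rw [Set.mem_Icc] at h1 h2
    have : (midpoint ℝ c.1 w.1) l = (c.1 l + w.1 l) / 2 := by
      simp [midpoint_eq_smul_add]; ring
    rw [this]
    constructor <;> linarith⟩
  have hzk : z.1 k = (c.1 k + w.1 k) / 2 := by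
    simp [z, midpoint_eq_smul_add]; ring
  have hcz : dist c z = t * L / 2 := by
    rw [← hcw, Subtype.dist_eq, Subtype.dist_eq]
    simp only [z, dist_left_midpoint]
    norm_num
    ring
  have hzw : dist z w = t * L / 2 := by
    rw [← hcw, Subtype.dist_eq, Subtype.dist_eq]
    simp only [z, dist_midpoint_right]
    norm_num
    ring
  -- Sides are tested only at coordinates strictly inside the cube, so the midpoint `z` replaces the
  -- corner. Moving its coordinate `k` to that of `w` strictly shortens the way to `y`, so `y` lies
  -- on the side of `w`, away from `c`.
  have hzy : X.d (X.proj i z) y.1 ≥ t * L / 2 + (1 - t) * L := by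
    have h1 := d_triangle hX x.1 (X.proj i z) y.1
    have h2 := d_proj_le i c z
    rw [hcx, hcz] at h2
    have h3 : X.d x.1 y.1 = L := rfl
    linarith
  have hwk : |w.1 k| ≤ 1 / 2 := w.abs_le k
  have hlt : X.d (X.proj i (z.upd k (w.1 k))) y.1 < X.d (X.proj i z) y.1 := by
    have h1 := d_triangle hX (X.proj i (z.upd k (w.1 k))) (X.proj i w) y.1
    have h2 := d_proj_le i (z.upd k (w.1 k)) w
    have h3 : dist (z.upd k (w.1 k)) w < dist z w := by
      refine Cube.dist_upd_lt hwk ?_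
      rw [sub_self, abs_zero, hzk, abs_pos]
      intro h
      exact hk (by linarith)
    rw [hw, hd1] at h1
    rw [hw] at h2
    linarith
  rw [← Cube.upd_eq_self z k, Cube.upd_upd, hzk] at hlt
  rw [← hcx, isNeg_corner hX hc]
  rcases Cube.eq_half_or_of_corner hc k with h | h
  · rw [h] at hck hlt hk ⊢
    have hw1 : w.1 k < 1 / 2 := lt_of_le_of_ne (abs_le.1 hwk).2 hk.symm
    rw [isNeg_iff hX hav z (s := w.1 k) (t := (1 / 2 + w.1 k) / 2) (by linarith) (by linarith)
      (by linarith)]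
    intro h1
    have := h1.2 hlt
    norm_num at this
  · rw [h] at hck hlt hk ⊢
    have hw1 : -(1 / 2) < w.1 k := lt_of_le_of_ne (abs_le.1 hwk).1 hk
    rw [isNeg_iff hX hav z (s := (-(1 / 2) + w.1 k) / 2) (t := w.1 k) (by linarith) (by linarith)
      (by linarith)]
    intro h1
    exact absurd (h1.1 rfl) (not_lt.2 hlt.le)

end CubeComplex

/-! ### Counting walls, and conditional negativity -/

section Walls

variable {V : Type*} {W : Type*}

/-- The set of the walls `w` that separate `x` and `y`, if `σ x w` tells the side of `w` on which
`x` lies. -/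
def separatingWalls (σ : V → W → Prop) (x y : V) : Set W := {w | ¬ (σ x w ↔ σ y w)}

theorem mem_separatingWalls {σ : V → W → Prop} {x y : V} {w : W} :
    w ∈ separatingWalls σ x y ↔ ¬ (σ x w ↔ σ y w) := Iff.rfl

theorem separatingWalls_self (σ : V → W → Prop) (x : V) : separatingWalls σ x x = ∅ := by
  ext w
  simp [mem_separatingWalls]

theorem separatingWalls_subset_union (σ : V → W → Prop) (x y z : V) :
    separatingWalls σ x z ⊆ separatingWalls σ x y ∪ separatingWalls σ y z := by
  intro w hw
  simp only [Set.mem_union, mem_separatingWalls] at hw ⊢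
  tauto

theorem separatingWalls_finite_of_walk {G : SimpleGraph V} {σ : V → W → Prop}
    (hadj : ∀ x y, G.Adj x y → ∃ w, separatingWalls σ x y = {w}) {x y : V} (p : G.Walk x y) :
    (separatingWalls σ x y).Finite ∧ (separatingWalls σ x y).ncard ≤ p.length := by
  induction p with
  | nil => simp [separatingWalls_self]
  | @cons x y z h p ih =>
    obtain ⟨w, hw⟩ := hadj x y h
    have hsub := separatingWalls_subset_union σ x y z
    rw [hw] at hsub
    have hfin : ({w} ∪ separatingWalls σ y z).Finite := (Set.finite_singleton w).union ih.1
    refine ⟨hfin.subset hsub, (Set.ncard_le_ncard hsub hfin).trans ?_⟩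
    refine (Set.ncard_union_le _ _).trans ?_
    rw [Set.ncard_singleton, SimpleGraph.Walk.length_cons]
    linarith [ih.2]

/-- In a connected graph with walls such that each edge crosses exactly one wall and such that from
`x` one can cross a wall separating it from `y` whenever `x ≠ y`, the distance is the number of
separating walls. -/
theorem dist_eq_ncard_separatingWalls {G : SimpleGraph V} (hG : G.Preconnected)
    {σ : V → W → Prop} (hadj : ∀ x y, G.Adj x y → ∃ w, separatingWalls σ x y = {w})
    (hex : ∀ x y, x ≠ y → ∃ x', G.Adj x x' ∧
      (separatingWalls σ x x' ∩ separatingWalls σ x y).Nonempty) (x y : V) :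
    (separatingWalls σ x y).Finite ∧ G.dist x y = (separatingWalls σ x y).ncard := by
  have hfin : ∀ x y, (separatingWalls σ x y).Finite := fun x y => by
    obtain ⟨p⟩ := hG x y
    exact (separatingWalls_finite_of_walk hadj p).1
  refine ⟨hfin x y, le_antisymm ?_ ?_⟩
  · induction hn : (separatingWalls σ x y).ncard using Nat.strong_induction_on generalizing x with
    | _ n ih =>
      by_cases hxy : x = y
      · simp [hxy]
      obtain ⟨x', hx', w, hw, hwy⟩ := hex x y hxy
      obtain ⟨w', hw'⟩ := hadj x x' hx'
      obtain rfl : w = w' := by simpa [hw'] using hw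
      -- The step to `x'` changes the side of `w` only, and `w` separated `x` from `y`; so the
      -- number of separating walls drops.
      have hsub : separatingWalls σ x' y ⊆ separatingWalls σ x y \ {w} := by
        intro v hv
        have hvw : v ∈ separatingWalls σ x x' ↔ v = w := by rw [hw']; rfl
        refine ⟨?_, fun hv' => ?_⟩
        · simp only [mem_separatingWalls] at *
          by_cases h : v = w
          · subst h; tauto
          · tauto
        · obtain rfl : v = w := hv'
          simp only [mem_separatingWalls] at *
          tauto
      have hlt : (separatingWalls σ x' y).ncard + 1 ≤ n := by
        rw [← hn, ← Set.ncard_sdiff_singleton_add_one hwy (hfin x y)]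
        exact Nat.add_le_add_right (Set.ncard_le_ncard hsub ((hfin x y).subset Set.sdiff_subset)) 1
      have h1 := ih _ (by omega) x' rfl
      have h2 : G.dist x y ≤ G.dist x' y + 1 := by
        obtain ⟨p, hp⟩ := (hG x' y).exists_walk_length_eq_dist
        rw [← hp]
        exact SimpleGraph.dist_le (SimpleGraph.Walk.cons hx' p)
      omega
  · obtain ⟨p, hp⟩ := (hG x y).exists_walk_length_eq_dist
    rw [← hp]
    exact (separatingWalls_finite_of_walk hadj p).2

end Walls

/-- Expanding the square, the pure terms carry the factor `∑ c = 0`, and `-2 (∑ c χ)²` remains. -/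
theorem sum_mul_sub_sq_nonpos {V : Type*} (s : Finset V) (c χ : V → ℝ) (hc : ∑ x ∈ s, c x = 0) :
    ∑ x ∈ s, ∑ y ∈ s, c x * c y * (χ x - χ y) ^ 2 ≤ 0 := by
  have h : ∑ x ∈ s, ∑ y ∈ s, c x * c y * (χ x - χ y) ^ 2 =
      (∑ x ∈ s, c x * χ x ^ 2) * (∑ y ∈ s, c y) + (∑ x ∈ s, c x) * (∑ y ∈ s, c y * χ y ^ 2) -
        2 * ((∑ x ∈ s, c x * χ x) * (∑ y ∈ s, c y * χ y)) := by
    rw [Finset.sum_mul_sum, Finset.sum_mul_sum, Finset.sum_mul_sum]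
    simp only [Finset.mul_sum, ← Finset.sum_add_distrib,
      ← Finset.sum_sub_distrib]
    refine Finset.sum_congr rfl fun x _ => Finset.sum_congr rfl fun y _ => ?_
    ring
  rw [h, hc]
  nlinarith [mul_self_nonneg (∑ x ∈ s, c x * χ x)]

/-- The number of separating walls is a conditionally negative kernel. -/
theorem isConditionallyNegativeKernel_ncard {V : Type u} {W : Type*} (σ : V → W → Prop)
    (hfin : ∀ x y, (separatingWalls σ x y).Finite) :
    IsConditionallyNegativeKernel fun x y => ((separatingWalls σ x y).ncard : ℝ) := by
  classical
  intro s c hc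
  let B : Finset W := s.biUnion fun x => s.biUnion fun y => (hfin x y).toFinset
  let χ : W → V → ℝ := fun w x => if σ x w then 1 else 0
  have hB : ∀ x ∈ s, ∀ y ∈ s, ((separatingWalls σ x y).ncard : ℝ) =
      ∑ w ∈ B, (χ w x - χ w y) ^ 2 := fun x hx y hy => by
    have h1 : separatingWalls σ x y = ↑(B.filter fun w => ¬ (σ x w ↔ σ y w)) := by
      ext w
      simp only [Finset.coe_filter, mem_separatingWalls, Set.mem_ofPred_eq]
      refine ⟨fun h => ⟨?_, h⟩, fun h => h.2⟩
      exact Finset.mem_biUnion.2 ⟨x, hx, Finset.mem_biUnion.2 ⟨y, hy, (hfin x y).mem_toFinset.2 h⟩⟩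
    rw [h1, Set.ncard_coe_finset, Finset.card_filter, Nat.cast_sum]
    refine Finset.sum_congr rfl fun w _ => ?_
    by_cases h2 : σ x w <;> by_cases h3 : σ y w <;> simp [χ, h2, h3]
  calc ∑ x ∈ s, ∑ y ∈ s, c x * c y * ((separatingWalls σ x y).ncard : ℝ)
      = ∑ x ∈ s, ∑ y ∈ s, ∑ w ∈ B, c x * c y * (χ w x - χ w y) ^ 2 := by
        refine Finset.sum_congr rfl fun x hx => Finset.sum_congr rfl fun y hy => ?_
        rw [hB x hx y hy, Finset.mul_sum]
    _ = ∑ w ∈ B, ∑ x ∈ s, ∑ y ∈ s, c x * c y * (χ w x - χ w y) ^ 2 := by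
        rw [Finset.sum_congr rfl fun x _ => Finset.sum_comm, Finset.sum_comm]
    _ ≤ 0 := Finset.sum_nonpos fun w _ => sum_mul_sub_sq_nonpos s c (χ w) hc

/-! ### The `ℓ¹`-distance in cubes -/

namespace Cube

variable {n m : ℕ}

/-- The `ℓ¹`-distance in the cube. -/
noncomputable def distOne (a b : Cube n) : ℝ := ∑ l, |a.1 l - b.1 l|

theorem distOne_nonneg (a b : Cube n) : 0 ≤ distOne a b :=
  Finset.sum_nonneg fun _ _ => abs_nonneg _

theorem distOne_triangle (a b c : Cube n) : distOne a c ≤ distOne a b + distOne b c := by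
  rw [distOne, distOne, distOne, ← Finset.sum_add_distrib]
  exact Finset.sum_le_sum fun l _ => abs_sub_le _ _ _

theorem distOne_le_sqrt_mul_dist (a b : Cube n) : distOne a b ≤ √n * dist a b := by
  refine abs_le_of_sq_le_sq' ?_ (by positivity) |>.2
  rw [mul_pow, Real.sq_sqrt (Nat.cast_nonneg n), dist_sq]
  have h := sq_sum_le_card_mul_sum_sq (s := Finset.univ) (f := fun l => |a.1 l - b.1 l|)
  simpa [distOne, sq_abs] using h

/-- Isometries of faces do not increase the `ℓ¹`-distance. -/
theorem distOne_map_le {x : Cube n} {y : Cube m} (h : x.support ≃ᵢ y.support)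
    (z w : x.support) : distOne (h z).1 (h w).1 ≤ distOne z.1 w.1 := by
  classical
  choose k hk τ hτ hkl using fun l : {l // l ∈ y.freeCoords} => exists_coord_map h.symm l.2
  have hinj : Function.Injective k := fun l l' hll => by
    by_contra hne
    have key : ∀ p : y.support, τ l * p.1.1 l = τ l' * p.1.1 l' := fun p => by
      rw [← hkl, ← hkl, hll]
    have h1 := key ⟨y.upd l' (1 / 2), upd_mem_support l'.2 _⟩
    have h2 := key ⟨y.upd l' (-(1 / 2)), upd_mem_support l'.2 _⟩
    have hne' : (l : Fin m) ≠ l' := fun h => hne (Subtype.ext h)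
    simp only [upd_of_ne _ _ hne'] at h1 h2
    rw [upd_self y l' (by norm_num [abs_of_pos])] at h1
    rw [upd_self y l' (by norm_num [abs_of_pos])] at h2
    rcases hτ l' with h3 | h3 <;> rw [h3] at h1 h2 <;> linarith
  have habs : ∀ (l : {l // l ∈ y.freeCoords}) (p : x.support), (h p).1.1 l = τ l * p.1.1 (k l) :=
    fun l p => by
      have h1 := hkl l (h p)
      rw [h.symm_apply_apply] at h1
      rcases hτ l with h3 | h3 <;> rw [h3] at h1 ⊢ <;> linarith
  calc distOne (h z).1 (h w).1
      = ∑ l ∈ y.freeCoords, |(h z).1.1 l - (h w).1.1 l| := by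
        symm
        refine Finset.sum_subset (Finset.subset_univ _) fun l _ hl => ?_
        rw [(h z).2 l hl, (h w).2 l hl, sub_self, abs_zero]
    _ = ∑ l : {l // l ∈ y.freeCoords}, |(h z).1.1 l - (h w).1.1 l| :=
        (Finset.sum_coe_sort y.freeCoords fun l => |(h z).1.1 l - (h w).1.1 l|).symm
    _ = ∑ l : {l // l ∈ y.freeCoords}, |z.1.1 (k l) - w.1.1 (k l)| := by
        refine Finset.sum_congr rfl fun l _ => ?_
        rw [habs l z, habs l w, ← mul_sub, abs_mul]
        rcases hτ l with h3 | h3 <;> simp [h3]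
    _ = ∑ i ∈ Finset.univ.map ⟨k, hinj⟩, |z.1.1 i - w.1.1 i| := by
        rw [Finset.sum_map]
        rfl
    _ ≤ distOne z.1 w.1 :=
        Finset.sum_le_sum_of_subset_of_nonneg (Finset.subset_univ _) fun _ _ _ => abs_nonneg _

/-- For corners `c` of the cube, the corner of the support of `a` nearest to `c` lies between. -/
theorem exists_corner_between (a : Cube n) {c : Cube n} (hc : c.freeCoords = ∅) :
    ∃ b ∈ a.support, b.freeCoords = ∅ ∧ distOne a b + distOne b c = distOne a c := by
  refine ⟨a.ofFree c.1 c.abs_le, ofFree_mem_support _ _ _, ?_, ?_⟩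
  · refine Finset.eq_empty_of_forall_notMem fun i hi => ?_
    rw [mem_freeCoords, ofFree_apply] at hi
    split_ifs at hi with h
    · have : i ∈ c.freeCoords := mem_freeCoords.2 hi
      simp [hc] at this
    · exact h (mem_freeCoords.2 hi)
  · rw [distOne, distOne, distOne, ← Finset.sum_add_distrib]
    refine Finset.sum_congr rfl fun i _ => ?_
    rw [ofFree_apply]
    split_ifs <;> simp

end Cube

/-! ### Edge paths from strings, the two metric bounds, and invariance -/

namespace CubeComplex

variable {X : CubeComplex.{u}}

/-- Flip the differing coordinates one at a time; each flip is a genuine edge and lowers the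
`ℓ¹`-distance by one. -/
theorem exists_walk_of_corners (hX : IsCAT0 X.Point)
    {i : X.Index} {c c' : Cube (X.dim i)} (hc : c.freeCoords = ∅)
    (hc' : c'.freeCoords = ∅) : ∃ p : X.oneSkeleton.Walk (vertexOf i c hc) (vertexOf i c' hc'),
      (p.length : ℝ) ≤ c.distOne c' := by
  classical
  induction hS : (Finset.univ.filter fun l => c.1 l ≠ c'.1 l) using Finset.induction_on
    generalizing c with
  | empty =>
    obtain rfl : c = c' := Cube.ext_coord fun l => by
      by_contra h
      have : l ∈ Finset.univ.filter fun l => c.1 l ≠ c'.1 l := by simp [h]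
      rw [hS] at this
      simp at this
    exact ⟨SimpleGraph.Walk.nil, by simpa using c.distOne_nonneg c⟩
  | insert k S hk ih =>
    have hkc : c.1 k ≠ c'.1 k := by
      have : k ∈ Finset.univ.filter fun l => c.1 l ≠ c'.1 l := by simp [hS]
      simpa using this
    have hck : -c.1 k = c'.1 k := by
      rcases Cube.eq_half_or_of_corner hc k with h1 | h1 <;>
        rcases Cube.eq_half_or_of_corner hc' k with h2 | h2 <;>
        rw [h1, h2] at hkc ⊢ <;> first | exact absurd rfl hkc | norm_num
    have hS' : (Finset.univ.filter fun l => (c.flip k).1 l ≠ c'.1 l) = S := by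
      ext l
      have hl : l ∈ Finset.univ.filter (fun l => c.1 l ≠ c'.1 l) ↔ l ∈ insert k S := by rw [hS]
      by_cases hlk : l = k
      · simp [hlk, Cube.flip_apply_self, hck, hk]
      · simpa [Cube.flip_apply_of_ne _ hlk, hlk] using hl
    obtain ⟨p, hp⟩ := ih (Cube.flip_corner hc k) hS'
    refine ⟨SimpleGraph.Walk.cons (adj_flip hc k (proj_flip_ne hX hc k)) p, ?_⟩
    have h1 : c.distOne c' = (c.flip k).distOne c' + 1 := by
      rw [Cube.distOne, Cube.distOne, ← Finset.add_sum_erase _ _ (Finset.mem_univ k),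
        ← Finset.add_sum_erase Finset.univ (fun l => |(c.flip k).1 l - c'.1 l|)
          (Finset.mem_univ k), Cube.flip_apply_self, hck, sub_self, abs_zero, zero_add, add_comm]
      congr 1
      · refine Finset.sum_congr rfl fun l hl => ?_
        rw [Cube.flip_apply_of_ne _ (Finset.ne_of_mem_erase hl)]
      · rw [← hck]
        rcases Cube.eq_half_or_of_corner hc k with h | h <;> rw [h] <;> norm_num
    rw [h1, SimpleGraph.Walk.length_cons]
    push_cast
    linarith

/-- A string from `P` to a vertex `y` is followed by an edge path from a corner of any cube that
contains `P`. -/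
theorem exists_walk_of_string (hX : IsCAT0 X.Point)
    {P Q : X.Point} {ℓ : ℝ≥0} (h : X.HasString P Q ℓ) {y : X.Vertex}
    (hy : y.1 = Q) {i : X.Index} {x : Cube (X.dim i)} (hx : X.proj i x = P) :
    ∃ (c : Cube (X.dim i)) (hc : c.freeCoords = ∅) (p : X.oneSkeleton.Walk (vertexOf i c hc) y),
      -- The path is chosen before `K`, so connectedness follows even when unbounded dimensions
      -- leave no such `K`.
      ∀ K : ℝ, (∀ (j : X.Index) (a b : Cube (X.dim j)), a.distOne b ≤ K * dist a b) →
        p.length + x.distOne c ≤ K * ℓ := by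
  induction h generalizing i x with
  | nil P =>
    obtain ⟨j, c, hc, hcy⟩ := y.exists_corner
    have hxe := freeCoords_eq_empty_of_proj_eq ((hx.trans hy.symm).trans hcy.symm) hc
    obtain rfl : vertexOf i x hxe = y := Subtype.ext (hx.trans hy.symm)
    exact ⟨x, hxe, SimpleGraph.Walk.nil, fun K _ => by simp [Cube.distOne]⟩
  | cons j a b Q ℓ _ ih =>
    obtain ⟨c, hc, p, hp⟩ := ih hy rfl
    -- Only the support of `a` is shared with the cube of `x`, so the path must first reach a corner
    -- of that face; choosing `e` between `a` and `c` costs no `ℓ¹`-length.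
    obtain ⟨e, hea, he, hdist⟩ := a.exists_corner_between hc
    obtain ⟨q, hq⟩ := exists_walk_of_corners hX he hc
    obtain ⟨h, hh, hax⟩ := exists_isometry hx.symm
    have hce := freeCoords_eq_empty_of_proj_eq (hh ⟨e, hea⟩).symm he
    have hv : vertexOf i (h ⟨e, hea⟩).1 hce = vertexOf j e he := Subtype.ext (hh ⟨e, hea⟩).symm
    refine ⟨(h ⟨e, hea⟩).1, hce, (q.append p).copy hv.symm rfl, fun K hK => ?_⟩
    have h1 := Cube.distOne_map_le h ⟨a, a.self_mem_support⟩ ⟨e, hea⟩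
    rw [hax] at h1
    have h2 := hp K hK
    have h3 := a.distOne_triangle b c
    have h4 := hK j a b
    rw [SimpleGraph.Walk.length_copy, SimpleGraph.Walk.length_append, NNReal.coe_add, coe_nndist]
    push_cast
    have h5 : x.distOne (h ⟨e, hea⟩).1 ≤ a.distOne e := h1
    nlinarith

theorem oneSkeleton_preconnected (hX : IsCAT0 X.Point) : X.oneSkeleton.Preconnected := fun x y => by
  obtain ⟨i, c, hc, hcx⟩ := x.exists_corner
  obtain ⟨ℓ, hℓ, -⟩ := exists_string_of_d_lt hX (lt_add_one (X.d x.1 y.1))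
  obtain ⟨e, he, p, -⟩ := exists_walk_of_string hX hℓ rfl hcx
  obtain ⟨q, -⟩ := exists_walk_of_corners hX hc he
  obtain rfl : vertexOf i c hc = x := Subtype.ext hcx
  exact ⟨q.append p⟩

theorem D_le_mul_of_string (hX : IsCAT0 X.Point)
    {x y : X.Vertex} {ℓ : ℝ≥0} (h : X.HasString x.1 y.1 ℓ) {K : ℝ}
    (hK : ∀ (j : X.Index) (a b : Cube (X.dim j)), a.distOne b ≤ K * dist a b) :
    X.D x y ≤ K * ℓ := by
  obtain ⟨i, c, hc, hcx⟩ := x.exists_corner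
  obtain ⟨e, he, p, hp⟩ := exists_walk_of_string hX h rfl hcx
  obtain ⟨q, hq⟩ := exists_walk_of_corners hX hc he
  obtain rfl : vertexOf i c hc = x := Subtype.ext hcx
  have h1 : X.D (vertexOf i c hc) y ≤ (q.append p).length :=
    Nat.cast_le.2 (SimpleGraph.dist_le (q.append p))
  rw [SimpleGraph.Walk.length_append, Nat.cast_add] at h1
  linarith [hp K hK]

theorem D_le_sqrt_mul_d (hX : IsCAT0 X.Point) {n : ℕ} (hn : X.dimension = n) (x y : X.Vertex) :
    X.D x y ≤ √n * X.d x.1 y.1 := by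
  have hK : ∀ (j : X.Index) (a b : Cube (X.dim j)), a.distOne b ≤ √n * dist a b := fun j a b => by
    refine (a.distOne_le_sqrt_mul_dist b).trans ?_
    have : (X.dim j : ℕ∞) ≤ n := hn ▸ le_iSup (fun i => (X.dim i : ℕ∞)) j
    have : X.dim j ≤ n := by exact_mod_cast this
    gcongr
  rw [mul_comm]
  refine le_of_forall_gt_imp_ge_of_dense fun r hr => ?_
  by_contra! hlt
  have h0 : ∀ s, X.d x.1 y.1 < s → X.D x y ≤ s * √n := fun s hs => by
    obtain ⟨ℓ, hℓ, hℓs⟩ := exists_string_of_d_lt hX hs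
    refine (D_le_mul_of_string hX hℓ hK).trans ?_
    rw [mul_comm]
    gcongr
  -- In dimension zero one cannot divide by `√n`; there any string already gives `D ≤ 0`.
  rcases (Real.sqrt_nonneg n).eq_or_lt with h | h
  · have := h0 _ (lt_add_one _)
    rw [← h, mul_zero] at this hr
    linarith
  · have := h0 (r / √n) ((lt_div_iff₀ h).2 hr)
    rw [div_mul_cancel₀ _ h.ne'] at this
    linarith

theorem d_le_length (hX : IsCAT0 X.Point)
    {x y : X.Vertex} (p : X.oneSkeleton.Walk x y) : X.d x.1 y.1 ≤ p.length := by
  induction p with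
  | nil => simp [d_self]
  | @cons x y z h p ih =>
    obtain ⟨i, c, k, hc, hcx, hcy⟩ := exists_flip_of_adj h
    have h1 := d_proj_le i (c.flip k) c
    rw [Cube.flip, Cube.dist_upd_self c k (by rw [abs_neg]; exact c.abs_le k), ← Cube.flip, hcx,
      hcy, d_comm] at h1
    have h2 : |-c.1 k - c.1 k| = 1 := by
      rcases Cube.eq_half_or_of_corner hc k with h | h <;> rw [h] <;> norm_num
    have h3 := d_triangle hX x.1 y.1 z.1
    rw [SimpleGraph.Walk.length_cons]
    push_cast
    linarith

theorem d_le_D (hX : IsCAT0 X.Point) (x y : X.Vertex) : X.d x.1 y.1 ≤ X.D x y := by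
  obtain ⟨p, hp⟩ := (oneSkeleton_preconnected hX x y).exists_walk_length_eq_dist
  rw [D, ← hp]
  exact d_le_length hX p

/-- The edge-path distance is the number of the separating hyperplanes. -/
theorem D_eq_ncard (hX : IsCAT0 X.Point) (x y : X.Vertex) :
    (separatingWalls (fun (v : X.Vertex) (w : Quotient X.Par) => IsNeg v.1 w.out) x y).Finite ∧
    X.oneSkeleton.dist x y =
      (separatingWalls (fun (v : X.Vertex) (w : Quotient X.Par) => IsNeg v.1 w.out) x y).ncard := by
  have hflip : ∀ {i : X.Index} {c : Cube (X.dim i)} (hc : c.freeCoords = ∅) (k : Fin (X.dim i)),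
      separatingWalls (fun (v : X.Vertex) (w : Quotient X.Par) => IsNeg v.1 w.out)
        (vertexOf i c hc) (vertexOf i (c.flip k) (Cube.flip_corner hc k)) =
        {Quotient.mk X.Par ⟨i, k⟩} := fun {i c} hc k => by
    ext w
    exact (not_congr (isNeg_flip hX hc k w.out)).trans
      (not_not.trans Quotient.eq_mk_iff_out.symm)
  refine dist_eq_ncard_separatingWalls (oneSkeleton_preconnected hX) (fun x y hxy => ?_)
    (fun x y hxy => ?_) x y
  · obtain ⟨i, c, k, hc, hcx, hcy⟩ := exists_flip_of_adj hxy
    obtain rfl : vertexOf i c hc = x := Subtype.ext hcx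
    obtain rfl : vertexOf i (c.flip k) (Cube.flip_corner hc k) = y := Subtype.ext hcy
    exact ⟨_, hflip hc k⟩
  · obtain ⟨i, c, k, hc, hcx, hsep⟩ := exists_flip_separating hX hxy
    obtain rfl : vertexOf i c hc = x := Subtype.ext hcx
    refine ⟨_, adj_flip hc k (proj_flip_ne hX hc k), Quotient.mk X.Par ⟨i, k⟩, ?_, ?_⟩
    · rw [hflip hc k]
      rfl
    · obtain ⟨j, e, he, hey⟩ := y.exists_corner
      -- The chosen representative `w.out` need not be `(i, k)`; separation is independent of this
      -- choice.
      have hpar := isNeg_par hX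
        (Quotient.mk_out (s := X.Par) (⟨i, k⟩ : Σ i : X.Index, Fin (X.dim i)))
        (p := X.proj i c) (q := y.1) (avoids_of_corner hc) (hey ▸ avoids_of_corner he)
      exact fun h => hsep (hpar.1 h)

/-- Elements act injectively and send edges to edges, hence give graph homomorphisms; the inverse
element supplies the reverse inequality in `D_vertexMap`. -/
theorem dist_vertexMap_le {G : Type v} [Group G] [MulAction G X.Point] (hG : X.IsCellularAction G)
    (hX : X.oneSkeleton.Preconnected) (g : G) (x y : X.Vertex) :
    X.oneSkeleton.dist (hG.vertexMap g x) (hG.vertexMap g y) ≤ X.oneSkeleton.dist x y := by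
  let f : X.oneSkeleton →g X.oneSkeleton := ⟨hG.vertexMap g, fun {a b} ⟨hne, e, he, hae, hbe⟩ =>
    ⟨fun h => hne (Subtype.ext (smul_left_cancel g (congrArg Subtype.val h))),
      _, hG g 1 e he, ⟨a.1, hae, rfl⟩, ⟨b.1, hbe, rfl⟩⟩⟩
  obtain ⟨p, hp⟩ := (hX x y).exists_walk_length_eq_dist
  rw [← hp, ← SimpleGraph.Walk.length_map f p]
  exact SimpleGraph.dist_le _

theorem D_vertexMap {G : Type v} [Group G] [MulAction G X.Point] (hG : X.IsCellularAction G)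
    (hX : X.oneSkeleton.Preconnected) (g : G) (x y : X.Vertex) :
    X.D (hG.vertexMap g x) (hG.vertexMap g y) = X.D x y := by
  have hinv : ∀ z : X.Vertex, hG.vertexMap g⁻¹ (hG.vertexMap g z) = z := fun z =>
    Subtype.ext (inv_smul_smul g z.1)
  refine congrArg Nat.cast (le_antisymm (dist_vertexMap_le hG hX g x y) ?_)
  have h := dist_vertexMap_le hG hX g⁻¹ (hG.vertexMap g x) (hG.vertexMap g y)
  rwa [hinv, hinv] at h

end CubeComplex

theorem mainTheorem2 (X : CubeComplex.{u}) (hX : IsCAT0 X.Point) :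
    X.oneSkeleton.Preconnected ∧
    IsConditionallyNegativeKernel X.D ∧
    (∀ (G : Type v) [Group G] [MulAction G X.Point] (hG : X.IsCellularAction G)
      (g : G) (x y : X.Vertex), X.D (hG.vertexMap g x) (hG.vertexMap g y) = X.D x y) ∧
    (∀ x y : X.Vertex, X.d x.1 y.1 ≤ X.D x y) ∧
    (∀ n : ℕ, X.dimension = n → ∀ x y : X.Vertex, X.D x y ≤ √(n : ℝ) * X.d x.1 y.1) := by
  have hc := CubeComplex.oneSkeleton_preconnected hX
  refine ⟨hc, ?_, fun G _ _ hG g x y => CubeComplex.D_vertexMap hG hc g x y,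
    CubeComplex.d_le_D hX, fun n hn => CubeComplex.D_le_sqrt_mul_d hX hn⟩
  have hD : X.D = fun x y => ((separatingWalls
      (fun (v : X.Vertex) (w : Quotient X.Par) => CubeComplex.IsNeg v.1 w.out) x y).ncard : ℝ) := by
    funext x y
    rw [CubeComplex.D, (CubeComplex.D_eq_ncard hX x y).2]
  rw [hD]
  exact isConditionallyNegativeKernel_ncard _ fun x y => (CubeComplex.D_eq_ncard hX x y).1
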